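/- **Setting.** Work in $\mathbb R^n$ with the Euclidean norm. Let $h:\mathbb R^n\to\mathbb R$ be convex, differentiable and $\beta$-smooth ($\|\nabla h(u)-\nabla h(v)\|\le\beta\|u-v\|$ for all $u,v$), bounded below, let $x_0\in\mathbb R^n$ and $\Delta=h(x_0)-\inf h$, and let $0<\gamma<\sqrt{2\beta\Delta}$. Put $f(x)=h(x)+\frac{\gamma^2}{16\Delta}\|x-x_0\|^2$ and $R=5\Delta/\gamma$. A (deterministic) gradient-query procedure adaptively asks for gradients at points and finally returns a point; only queries are counted. A CGM oracle with constant $c$ assigns to all $\zeta>0$, $w\in\mathbb R^n$, $\epsilon>0$ a procedure $\mathrm{CGM}(\zeta,w,\epsilon)$ that returns an $\epsilon$-minimizer of $f$ over the closed ball $B_\zeta(w)$, i.e. a $u\in B_\zeta(w)$ with $f(u)\le f(v)+\epsilon$ for all $v\in B_\zeta(w)$, using at most $c\,(1+\sqrt{\beta\zeta^2/\epsilon})$ queries to $\nabla f$. **Algorithm.** Let $\lambda_k=2^k/32$, $\epsilon_k=\Delta/(64\cdot 1.5^k)$ and $\Lambda_k=\sum_{j=0}^{k-1}\lambda_j$.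 Set $z_0=x_0$; for $k=1,\dots,K$ put $$w_k=\frac{z_0+\sum_{j=0}^{k-1}\lambda_jz_j}{1+\Lambda_k},\qquad z_k=\mathrm{CGM}\Bigl(\frac{R}{1+\Lambda_k},\,w_k,\,\frac{\epsilon_k}{1+\Lambda_k}\Bigr);$$ return $z_K$. Each query to $\nabla f(x)=\nabla h(x)+\frac{\gamma^2}{8\Delta}(x-x_0)$ is carried out by one query to $\nabla h$. **Theorem.** Let $K_0=\lceil\log_{3/2}(16\sqrt{\beta\Delta}/\gamma)\rceil$. 1. For all constants $c$ and $A$ there is a constant $C>0$, depending only on $c$ and $A$, such that for all $n,\beta,\Delta,\gamma,x_0,h$ as above, every CGM oracle with constant $c$ and every integer $K$ with $K_0\le K\le A K_0$, the output of the algorithm satisfies $\|\nabla h(z_K)\|\le\gamma$, and the algorithm makes at most $C\sqrt{\beta\Delta}/\gamma$ gradient queries to $h$. 2. There is a universal constant $c$ for which CGM oracles exist: for all $n,\beta,\Delta,\gamma,x_0$ there is one that depends only on these data and is a CGM oracle with constant $c$ for every $h$ as above. Hence $O(\sqrt{\beta\Delta}/\gamma)$ gradient queries suffice. 3. This is optimal: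 there is a universal constant $c'>0$ such that for all $\beta,\Delta>0$ and $0<\gamma<\sqrt{2\beta\Delta}$ there is an $N$ such that for all $n\ge N$ and $x_0\in\mathbb R^n$, every deterministic gradient-query procedure that, for every convex, $\beta$-smooth, bounded below $h:\mathbb R^n\to\mathbb R$ with $h(x_0)-\inf h=\Delta$, returns a point $z$ with $\|\nabla h(z)\|\le\gamma$, makes at least $c'\sqrt{\beta\Delta}/\gamma$ gradient queries for some such $h$. -/

import Mathlib

namespace CriticalPoint

/-- A deterministic adaptive procedure with access to a vector-field oracle `V → V`, returning a
value of type `α`: it either stops with a value, or asks for the oracle's answer at a point and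
continues in a way that depends on the answer.  Computation between two queries is unrestricted,
as in the usual oracle model; only queries are counted. -/
inductive Procedure (V α : Type) : Type
  | done (a : α) : Procedure V α
  | query (x : V) (next : V → Procedure V α) : Procedure V α

namespace Procedure

variable {V α α' : Type}

/-- The value returned when every query at `x` is answered by `G x`. -/
def run (G : V → V) : Procedure V α → α
  | done a => a
  | query x next => run G (next (G x))

/-- The number of queries made when every query at `x` is answered by `G x`. -/
def numQueries (G : V → V) : Procedure V α → ℕ
  | done _ => 0
  | query x next => numQueries G (next (G x)) + 1

/-- Sequential composition. -/
def bind : Procedure V α → (α → Procedure V α') → Procedure V α'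
  | done a, q => q a
  | query x next, q => query x (fun g => bind (next g) q)

/-- Replace the oracle: a query at `x` is still made at `x`, with one query, but the answer `g` is
turned into `corr x g` before it is handed to the procedure. -/
def translate (corr : V → V → V) : Procedure V α → Procedure V α
  | done a => done a
  | query x next => query x (fun g => translate corr (next (corr x g)))

end Procedure

section Setting

variable {V : Type} [NormedAddCommGroup V] [InnerProductSpace ℝ V]

/-- The set of `ε`-minimizers of `f` over `U`. -/
def epsArgmin (ε : ℝ) (U : Set V) (f : V → ℝ) : Set V :=
  {u | u ∈ U ∧ ∀ v ∈ U, f u - ε ≤ f v}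

/-- `h` is convex and `β`-smooth, is bounded below, and `h x₀ - inf h = Δ`. -/
structure IsInstance [CompleteSpace V] (β Δ : ℝ) (x₀ : V) (h : V → ℝ) : Prop where
  convex : ConvexOn ℝ Set.univ h
  differentiable : Differentiable ℝ h
  smooth : ∀ u v : V, ‖gradient h u - gradient h v‖ ≤ β * ‖u - v‖
  bddBelow : BddBelow (Set.range h)
  gap : h x₀ - ⨅ x, h x = Δ

/-- The regularized function `f(x) = h(x) + γ² / (16 Δ) ‖x - x₀‖²`. -/
noncomputable def regularized (Δ γ : ℝ) (x₀ : V) (h : V → ℝ) (x : V) : ℝ :=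
  h x + γ ^ 2 / (16 * Δ) * ‖x - x₀‖ ^ 2

/-- `cgm` is a fast composite gradient method oracle for `f`: for all `ζ > 0`, `w`, `ε > 0`, when
its queries are answered by `∇f`, the procedure `cgm ζ w ε` returns an `ε`-minimizer of `f` over
the closed ball of radius `ζ` around `w`, after at most `c (1 + √(β ζ² / ε))` queries. -/
def IsCGM [CompleteSpace V] (β c : ℝ) (f : V → ℝ) (cgm : ℝ → V → ℝ → Procedure V V) : Prop :=
  ∀ (ζ : ℝ) (w : V) (ε : ℝ), 0 < ζ → 0 < ε →
    (cgm ζ w ε).run (gradient f) ∈ epsArgmin ε (Metric.closedBall w ζ) f ∧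
    ((cgm ζ w ε).numQueries (gradient f) : ℝ) ≤ c * (1 + √(β * ζ ^ 2 / ε))

/-- The dual-regularization schedule `λ_k = 2^k / 32`. -/
noncomputable def lam (k : ℕ) : ℝ := 2 ^ k / 32

/-- The primal-accuracy schedule `ε_k = Δ / (64 · 1.5^k)`. -/
noncomputable def eps (Δ : ℝ) (k : ℕ) : ℝ := Δ / (64 * (3 / 2) ^ k)

/-- `Λ_k = ∑_{j < k} λ_j`. -/
noncomputable def Lam (k : ℕ) : ℝ := ∑ j ∈ Finset.range k, lam j

/-- The center `w_k = (z_0 + ∑_{j < k} λ_j z_j) / (1 + Λ_k)`. -/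
noncomputable def center (z : ℕ → V) (k : ℕ) : V :=
  (1 / (1 + Lam k)) • (z 0 + ∑ j ∈ Finset.range k, lam j • z j)

/-- The first `K` iterations, querying `∇f`.  The value returned is a sequence whose entries with
index `0, …, K` are the iterates `z_0, …, z_K`: `z_0 = x₀`, and for `k = 1, …, K`
`z_k = CGM (R / (1 + Λ_k), w_k, ε_k / (1 + Λ_k))` with `R = 5 Δ / γ`. -/
noncomputable def iterates (Δ γ : ℝ) (x₀ : V) (cgm : ℝ → V → ℝ → Procedure V V) :
    ℕ → Procedure V (ℕ → V)
  | 0 => .done (fun _ => x₀)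
  | k + 1 =>
    (iterates Δ γ x₀ cgm k).bind fun z =>
      (cgm (5 * Δ / γ / (1 + Lam (k + 1))) (center z (k + 1))
          (eps Δ (k + 1) / (1 + Lam (k + 1)))).bind fun z' =>
        .done (Function.update z (k + 1) z')

/-- The algorithm with `K` iterations, querying `∇h` and returning `z_K`.  A query to `∇f` is one
query to `∇h`, since `∇f(x) = ∇h(x) + γ² / (8 Δ) (x - x₀)`. -/
noncomputable def algorithm (Δ γ : ℝ) (x₀ : V) (cgm : ℝ → V → ℝ → Procedure V V) (K : ℕ) :
    Procedure V V :=
  ((iterates Δ γ x₀ cgm K).bind fun z => .done (z K)).translate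
    fun x g => g + (γ ^ 2 / (8 * Δ)) • (x - x₀)

end Setting

/-- The iteration count `⌈log_{3/2} (16 √(β Δ) / γ)⌉`. -/
noncomputable def iterationCount (β Δ γ : ℝ) : ℕ := ⌈Real.logb (3 / 2) (16 * √(β * Δ) / γ)⌉₊

end CriticalPoint

open CriticalPoint

/-! Guarantee. Let `f` be the regularized function, `x*` its minimizer and `g = ∇f(x)`. Since `⟨g,
x⟩ - f(x)` is the conjugate `f*(g)`, `dualPotential` is the dual objective `f*(g) - ⟨g, z_0⟩ + R‖g‖`
plus the Bregman divergences `D(z_j, x)` with weights `λ_j`. These dual regularizers turn the primal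
problem into the minimization of `f` over the ball of radius `R / (1 + Λ_k)` around `w_k`; let `y_k`
be its exact solution. Weak and strong duality (`le_dualPotential`, `dualPotential_le_of_isMinOn`)
say that `y_k` also solves the dual problem. Passing to `k + 1` raises the potential at `y_k` by
`λ_k D(z_k, y_k) ≤ ε_k`, which is summable, so the potential at `y_K` is at most `-f(x*) + Δ/16`.
Convexity bounds it below by `R‖∇f(y_K)‖ - f(x_0)`, whence `‖∇f(y_K)‖ = O(Δ/R) = O(γ)`
(`radius_mul_norm_gradient_le`). Co-coercivity carries this bound to `z_K`, and strong convexity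
controls the gradient of the regularizer there (`norm_gradient_iterate_le`).

The cost has no logarithmic factor because `λ_k` doubles while `ε_k` shrinks only by `3/2`: the
query bounds decay geometrically (`numQueries_iterates_le`). The oracle itself is Nesterov's
accelerated projected gradient method (`exists_isCGM`).

Optimality. On a chain of springs whose directions are chosen adaptively, each query reveals at most
one new direction (`exists_resisting_chain`). A point orthogonal to the last direction still has a
large gradient (`sq_le_norm_chainGrad_sq`), and a soft first spring gives the right dependence on
`Δ`. -/

namespace CriticalPoint

/-! ### Smooth convex functions -/

section SmoothConvex

variable {V : Type} [NormedAddCommGroup V] [InnerProductSpace ℝ V] [CompleteSpace V]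

theorem hasDerivAt_along_line {f : V → ℝ} (hd : Differentiable ℝ f) (x d : V) (t : ℝ) :
    HasDerivAt (fun s : ℝ => f (x + s • d)) (inner ℝ (gradient f (x + t • d)) d) t := by
  have h1 : HasDerivAt (fun s : ℝ => x + s • d) d t := by
    simpa using ((hasDerivAt_id t).smul_const d).const_add x
  have h2 := ((hd (x + t • d)).hasFDerivAt).comp_hasDerivAt t h1
  rwa [← inner_gradient_left] at h2

/-- The first-order characterization of convexity. -/
theorem convex_first_order {f : V → ℝ} (hc : ConvexOn ℝ Set.univ f) (hd : Differentiable ℝ f)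
    (x y : V) : f x + inner ℝ (gradient f x) (y - x) ≤ f y := by
  have hφ : ConvexOn ℝ Set.univ (fun s : ℝ => f (x + s • (y - x))) := by
    refine ⟨convex_univ, fun a _ b _ p q hp hq hpq => ?_⟩
    have := hc.2 (Set.mem_univ (x + a • (y - x))) (Set.mem_univ (x + b • (y - x))) hp hq hpq
    convert this using 2
    have hx : x = p • x + q • x := by rw [← add_smul, hpq, one_smul]
    nth_rewrite 1 [hx]
    simp only [smul_eq_mul, smul_add, add_smul, smul_smul]
    abel
  have hder := hasDerivAt_along_line hd x (y - x) 0
  have := hφ.le_slope_of_hasDerivAt (Set.mem_univ 0) (Set.mem_univ 1) one_pos hder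
  simp only [slope_def_field, zero_smul, add_zero, one_smul, add_sub_cancel, sub_zero,
    div_one] at this
  linarith

/-- The quadratic upper bound for functions with Lipschitz gradient. -/
theorem smooth_upper_bound {f : V → ℝ} {L : ℝ} (hd : Differentiable ℝ f)
    (hs : ∀ u v : V, ‖gradient f u - gradient f v‖ ≤ L * ‖u - v‖) (x y : V) :
    f y ≤ f x + inner ℝ (gradient f x) (y - x) + L / 2 * ‖y - x‖ ^ 2 := by
  set d := y - x with hd'
  -- The Lipschitz bound makes `ψ` nonincreasing on `[0, 1]`; the claim is `ψ 1 ≤ ψ 0`.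
  let ψ : ℝ → ℝ := fun t => f (x + t • d) - t * inner ℝ (gradient f x) d - L / 2 * ‖d‖ ^ 2 * t ^ 2
  have hψ : ∀ t, HasDerivAt ψ (inner ℝ (gradient f (x + t • d)) d - inner ℝ (gradient f x) d
      - L * ‖d‖ ^ 2 * t) t := by
    intro t
    have h1 := hasDerivAt_along_line hd x d t
    have h2 := (hasDerivAt_id t).mul_const (inner ℝ (gradient f x) d)
    have h3 := ((hasDerivAt_id t).pow 2).const_mul (L / 2 * ‖d‖ ^ 2)
    refine ((h1.sub h2).sub h3).congr_deriv ?_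
    simp only [id, one_mul, Nat.cast_ofNat, Nat.add_one_sub_one, pow_one]
    ring
  have hanti : AntitoneOn ψ (Set.Icc 0 1) := by
    refine antitoneOn_of_deriv_nonpos (convex_Icc 0 1)
      (fun t _ => (hψ t).continuousAt.continuousWithinAt)
      (fun t _ => (hψ t).differentiableAt.differentiableWithinAt) ?_
    intro t ht
    rw [interior_Icc] at ht
    rw [(hψ t).deriv, ← inner_sub_left]
    have h1 := real_inner_le_norm (gradient f (x + t • d) - gradient f x) d
    have h2 := hs (x + t • d) x
    rw [add_sub_cancel_left, norm_smul, Real.norm_eq_abs, abs_of_pos ht.1] at h2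
    nlinarith [norm_nonneg d, mul_le_mul_of_nonneg_right h2 (norm_nonneg d)]
  have := hanti (Set.left_mem_Icc.2 zero_le_one) (Set.right_mem_Icc.2 zero_le_one) zero_le_one
  have hy : x + (1 : ℝ) • d = y := by simp [hd']
  simp only [ψ, hy, zero_smul, add_zero] at this
  linarith

/-- Co-coercivity of the gradient of a smooth convex function, in Bregman form. -/
theorem norm_gradient_sub_sq_le {f : V → ℝ} {L : ℝ} (hL : 0 < L) (hc : ConvexOn ℝ Set.univ f)
    (hd : Differentiable ℝ f) (hs : ∀ u v : V, ‖gradient f u - gradient f v‖ ≤ L * ‖u - v‖)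
    (z x : V) : ‖gradient f z - gradient f x‖ ^ 2 ≤
      2 * L * (f z - f x - inner ℝ (gradient f x) (z - x)) := by
  set g := gradient f z - gradient f x with hg
  -- The point `z - g / L` minimizes the quadratic upper model at `z` minus the tangent plane at
  -- `x`; this difference is nonnegative everywhere.
  have h1 := convex_first_order hc hd x (z - L⁻¹ • g)
  have h2 := smooth_upper_bound hd hs z (z - L⁻¹ • g)
  have e1 : z - L⁻¹ • g - x = (z - x) - L⁻¹ • g := by abel
  have e2 : z - L⁻¹ • g - z = -(L⁻¹ • g) := by abel
  rw [e1, inner_sub_right, inner_smul_right] at h1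
  rw [e2, inner_neg_right, inner_smul_right, norm_neg, norm_smul, Real.norm_eq_abs,
    abs_of_pos (inv_pos.2 hL)] at h2
  have h3 : inner ℝ (gradient f z) g - inner ℝ (gradient f x) g = ‖g‖ ^ 2 := by
    rw [← inner_sub_left, ← hg, real_inner_self_eq_norm_sq]
  have h4 : L / 2 * (L⁻¹ * ‖g‖) ^ 2 = L⁻¹ * ‖g‖ ^ 2 / 2 := by field_simp
  have h5 : L⁻¹ * inner ℝ (gradient f z) g = L⁻¹ * ‖g‖ ^ 2 + L⁻¹ * inner ℝ (gradient f x) g := by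
    rw [← h3]; ring
  have h6 : L⁻¹ * ‖g‖ ^ 2 ≤ 2 * (f z - f x - inner ℝ (gradient f x) (z - x)) := by linarith
  have h7 := mul_le_mul_of_nonneg_left h6 hL.le
  rw [mul_inv_cancel_left₀ hL.ne'] at h7
  linarith

/-- The variational inequality for a minimizer over a convex set. -/
theorem inner_gradient_nonneg_of_isMinOn {f : V → ℝ} (hd : Differentiable ℝ f) {s : Set V}
    (hs : Convex ℝ s) {x y : V} (hx : x ∈ s) (hy : y ∈ s) (hmin : IsMinOn f s x) :
    0 ≤ inner ℝ (gradient f x) (y - x) := by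
  rw [inner_gradient_left]
  exact hmin.localize.hasFDerivWithinAt_nonneg (hd x).hasFDerivAt.hasFDerivWithinAt
    (mem_posTangentConeAt_of_segment_subset
      (by rw [add_sub_cancel]; exact hs.segment_subset hx hy))

end SmoothConvex

/-! ### The regularized function -/

section Regularized

variable {V : Type} [NormedAddCommGroup V] [InnerProductSpace ℝ V] [CompleteSpace V]

theorem hasGradientAt_norm_sub_sq (c : ℝ) (x₀ x : V) :
    HasGradientAt (fun x => c * ‖x - x₀‖ ^ 2) ((2 * c) • (x - x₀)) x := by
  rw [hasGradientAt_iff_hasFDerivAt]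
  have h := ((hasFDerivAt_id x).sub_const x₀).norm_sq.const_mul c
  refine HasFDerivAt.congr_fderiv h ?_
  ext v
  simp only [id, map_smul, InnerProductSpace.toDual_apply_apply, smul_apply,
    nsmul_eq_mul, smul_eq_mul, ContinuousLinearMap.comp_id, innerSL_apply_apply]
  simp
  ring

theorem hasGradientAt_regularized {Δ γ : ℝ} {x₀ : V} {h : V → ℝ} (hd : Differentiable ℝ h) (x : V) :
    HasGradientAt (regularized Δ γ x₀ h) (gradient h x + (γ ^ 2 / (8 * Δ)) • (x - x₀)) x := by
  have h1 := (hd x).hasGradientAt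
  have h2 := hasGradientAt_norm_sub_sq (γ ^ 2 / (16 * Δ)) x₀ x
  have e : 2 * (γ ^ 2 / (16 * Δ)) = γ ^ 2 / (8 * Δ) := by
    rw [show (16 : ℝ) * Δ = 2 * (8 * Δ) by ring]
    by_cases hΔ : Δ = 0
    · simp [hΔ]
    · field_simp
  rw [e] at h2
  rw [hasGradientAt_iff_hasFDerivAt] at h1 h2 ⊢
  rw [map_add]
  exact h1.add h2

theorem gradient_regularized {Δ γ : ℝ} {x₀ : V} {h : V → ℝ} (hd : Differentiable ℝ h) :
    gradient (regularized Δ γ x₀ h) = fun x => gradient h x + (γ ^ 2 / (8 * Δ)) • (x - x₀) :=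
  gradient_eq fun x => hasGradientAt_regularized hd x

theorem differentiable_regularized {Δ γ : ℝ} {x₀ : V} {h : V → ℝ} (hd : Differentiable ℝ h) :
    Differentiable ℝ (regularized Δ γ x₀ h) :=
  fun x => (hasGradientAt_regularized hd x).differentiableAt

theorem regularized_strong_first_order {Δ γ : ℝ} {x₀ : V} {h : V → ℝ} (hΔ : 0 < Δ)
    (hc : ConvexOn ℝ Set.univ h) (hd : Differentiable ℝ h) (x y : V) :
    regularized Δ γ x₀ h x + inner ℝ (gradient (regularized Δ γ x₀ h) x) (y - x)
      + γ ^ 2 / (16 * Δ) * ‖y - x‖ ^ 2 ≤ regularized Δ γ x₀ h y := by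
  have h1 := convex_first_order hc hd x y
  rw [gradient_regularized hd]
  simp only [regularized, inner_add_left, inner_smul_left, conj_trivial]
  have e : y - x₀ = (x - x₀) + (y - x) := by abel
  have h2 : ‖y - x₀‖ ^ 2 = ‖x - x₀‖ ^ 2 + 2 * inner ℝ (x - x₀) (y - x) + ‖y - x‖ ^ 2 := by
    rw [e, norm_add_sq_real]
  rw [h2]
  have h3 : γ ^ 2 / (8 * Δ) = 2 * (γ ^ 2 / (16 * Δ)) := by field_simp; ring
  rw [h3]
  linarith

theorem convexOn_regularized {V : Type} [NormedAddCommGroup V] [InnerProductSpace ℝ V]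
    {Δ γ : ℝ} {x₀ : V} {h : V → ℝ} (hΔ : 0 < Δ)
    (hc : ConvexOn ℝ Set.univ h) : ConvexOn ℝ Set.univ (regularized Δ γ x₀ h) := by
  have h1 : ConvexOn ℝ Set.univ (fun x : V => ‖x - x₀‖) := by
    simpa [dist_eq_norm] using convexOn_univ_dist x₀
  exact hc.add ((h1.pow (fun x _ => norm_nonneg _) 2).smul (by positivity : 0 ≤ γ ^ 2 / (16 * Δ)))

/-- The regularizer has curvature `γ² / (8 Δ) ≤ β / 4`, which is where `5/4` comes from. -/
theorem smooth_regularized {β Δ γ : ℝ} {x₀ : V} {h : V → ℝ} (hΔ : 0 < Δ)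
    (hγ : γ ^ 2 ≤ 2 * β * Δ) (hd : Differentiable ℝ h)
    (hs : ∀ u v : V, ‖gradient h u - gradient h v‖ ≤ β * ‖u - v‖) (u v : V) :
    ‖gradient (regularized Δ γ x₀ h) u - gradient (regularized Δ γ x₀ h) v‖
      ≤ 5 / 4 * β * ‖u - v‖ := by
  rw [gradient_regularized hd]
  have e : gradient h u + (γ ^ 2 / (8 * Δ)) • (u - x₀) -
      (gradient h v + (γ ^ 2 / (8 * Δ)) • (v - x₀)) =
      (gradient h u - gradient h v) + (γ ^ 2 / (8 * Δ)) • (u - v) := by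
    simp only [smul_sub]; abel
  have hσ : γ ^ 2 / (8 * Δ) ≤ β / 4 := by
    rw [div_le_iff₀ (by positivity)]; linarith
  have h2 : ‖(γ ^ 2 / (8 * Δ)) • (u - v)‖ ≤ β / 4 * ‖u - v‖ := by
    rw [norm_smul, Real.norm_of_nonneg (by positivity)]
    gcongr
  simp only [e]
  linarith [norm_add_le (gradient h u - gradient h v) ((γ ^ 2 / (8 * Δ)) • (u - v)), hs u v]

/-- The parameters of an instance with `γ < √(2 β Δ)` are positive. -/
theorem IsInstance.pos {β Δ γ : ℝ} {x₀ : V} {h : V → ℝ} (H : IsInstance β Δ x₀ h) (hγ : 0 < γ)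
    (hγ' : γ < √(2 * β * Δ)) : 0 < β ∧ 0 < Δ ∧ γ ^ 2 < 2 * β * Δ := by
  have h1 : γ ^ 2 < 2 * β * Δ := (Real.lt_sqrt hγ.le).1 hγ'
  have h2 : 0 ≤ Δ := by
    rw [← H.gap]
    linarith [ciInf_le H.bddBelow x₀]
  have h3 : 0 < Δ := h2.lt_of_ne (by rintro rfl; nlinarith)
  refine ⟨?_, h3, h1⟩
  by_contra hb
  nlinarith [mul_nonneg (sub_nonneg.2 (not_lt.1 hb)) h2]

theorem IsInstance.sub_le {β Δ : ℝ} {x₀ : V} {h : V → ℝ} (H : IsInstance β Δ x₀ h) (x : V) :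
    h x₀ - h x ≤ Δ := by
  rw [← H.gap]
  linarith [ciInf_le H.bddBelow x]

theorem regularized_self {V : Type} [NormedAddCommGroup V] [InnerProductSpace ℝ V]
    {Δ γ : ℝ} {x₀ : V} {h : V → ℝ} : regularized Δ γ x₀ h x₀ = h x₀ := by
  simp [regularized]

/-- The regularized function has a global minimizer. -/
theorem exists_isMinOn_regularized [FiniteDimensional ℝ V] {β Δ γ : ℝ} {x₀ : V} {h : V → ℝ}
    (H : IsInstance β Δ x₀ h) (hγ : 0 < γ) (hΔ : 0 < Δ) :
    ∃ x, ∀ y, regularized Δ γ x₀ h x ≤ regularized Δ γ x₀ h y := by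
  have : ProperSpace V := FiniteDimensional.proper_real V
  -- At radius `4 Δ / γ` the regularizer equals `Δ`, the largest possible decrease of `h`, so no
  -- point outside this ball beats `x₀`.
  obtain ⟨x, -, hx⟩ := (isCompact_closedBall x₀ (4 * Δ / γ)).exists_isMinOn
    ⟨x₀, Metric.mem_closedBall_self (by positivity)⟩
    (differentiable_regularized (Δ := Δ) (γ := γ) (x₀ := x₀)
      H.differentiable).continuous.continuousOn
  refine ⟨x, fun y => ?_⟩
  by_cases hy : y ∈ Metric.closedBall x₀ (4 * Δ / γ)
  · exact hx hy
  · refine (hx (Metric.mem_closedBall_self (by positivity))).trans ?_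
    rw [regularized_self]
    rw [Metric.mem_closedBall, dist_eq_norm, not_le] at hy
    have h1 : (4 * Δ / γ) ^ 2 ≤ ‖y - x₀‖ ^ 2 := by gcongr
    have h2 : γ ^ 2 / (16 * Δ) * (4 * Δ / γ) ^ 2 = Δ := by field_simp; norm_num
    have h3 : γ ^ 2 / (16 * Δ) * (4 * Δ / γ) ^ 2 ≤ γ ^ 2 / (16 * Δ) * ‖y - x₀‖ ^ 2 := by gcongr
    have := H.sub_le y
    unfold regularized
    linarith

end Regularized

/-! ### Composition and translation of procedures -/

namespace Procedure

variable {V α α' : Type}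

@[simp] theorem run_bind (G : V → V) (p : Procedure V α) (q : α → Procedure V α') :
    (p.bind q).run G = (q (p.run G)).run G := by
  induction p with
  | done a => rfl
  | query x next ih => exact ih (G x)

@[simp] theorem numQueries_bind (G : V → V) (p : Procedure V α) (q : α → Procedure V α') :
    (p.bind q).numQueries G = p.numQueries G + (q (p.run G)).numQueries G := by
  induction p with
  | done a => simp [bind, numQueries, run]
  | query x next ih =>
    simp only [bind, numQueries, run, ih (G x)]
    ring

theorem run_translate (G : V → V) (corr : V → V → V) (p : Procedure V α) :
    (p.translate corr).run G = p.run (fun x => corr x (G x)) := by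
  induction p with
  | done a => rfl
  | query x next ih => exact ih _

theorem numQueries_translate (G : V → V) (corr : V → V → V) (p : Procedure V α) :
    (p.translate corr).numQueries G = p.numQueries (fun x => corr x (G x)) := by
  induction p with
  | done a => rfl
  | query x next ih => simp only [translate, numQueries, ih]

end Procedure

/-! ### The parameter schedules -/

theorem Lam_eq (k : ℕ) : Lam k = (2 ^ k - 1) / 32 := by
  induction k with
  | zero => simp [Lam]
  | succ k ih =>
    have : Lam (k + 1) = Lam k + lam k := Finset.sum_range_succ _ _
    rw [this, ih, lam, pow_succ]
    ring

theorem one_add_Lam_pos (k : ℕ) : 0 < 1 + Lam k := by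
  rw [Lam_eq]
  have : (1 : ℝ) ≤ 2 ^ k := one_le_pow₀ (by norm_num)
  linarith

theorem lam_pos (k : ℕ) : 0 < lam k := by unfold lam; positivity

theorem lam_le_one_add_Lam (k : ℕ) : lam k ≤ 1 + Lam k := by
  rw [Lam_eq, lam]; linarith

theorem eps_pos {Δ : ℝ} (hΔ : 0 < Δ) (k : ℕ) : 0 < eps Δ k := by unfold eps; positivity

/-! ### Duality for the subproblems -/

section Potential

variable {V : Type} [NormedAddCommGroup V] [InnerProductSpace ℝ V]

theorem one_add_Lam_smul_center (z : ℕ → V) (k : ℕ) :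
    (1 + Lam k) • center z k = z 0 + ∑ j ∈ Finset.range k, lam j • z j := by
  rw [center, smul_smul, mul_one_div_cancel (one_add_Lam_pos k).ne', one_smul]

theorem center_congr {z z' : ℕ → V} {k : ℕ} (hk : 0 < k) (h : ∀ j < k, z j = z' j) :
    center z k = center z' k := by
  unfold center
  rw [h 0 hk]
  congr 2
  exact Finset.sum_congr rfl fun j hj => by rw [h j (Finset.mem_range.1 hj)]

variable [CompleteSpace V]

/-- The dual objective of the `k`-th iteration at the dual point `∇f(x)`. -/
noncomputable def dualPotential (f : V → ℝ) (R : ℝ) (z : ℕ → V) (k : ℕ) (x : V) : ℝ :=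
  inner ℝ (gradient f x) (x - z 0) - f x + R * ‖gradient f x‖ +
    ∑ j ∈ Finset.range k, lam j * (f (z j) - f x - inner ℝ (gradient f x) (z j - x))

theorem dualPotential_succ (f : V → ℝ) (R : ℝ) (z : ℕ → V) (k : ℕ) (x : V) :
    dualPotential f R z (k + 1) x = dualPotential f R z k x +
      lam k * (f (z k) - f x - inner ℝ (gradient f x) (z k - x)) := by
  rw [dualPotential, Finset.sum_range_succ, dualPotential]
  ring

/-- Collecting the linear terms in `∇f(x)` produces the center `w_k`; this is why the dual
regularizers correspond to a ball around it. -/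
theorem dualPotential_eq (f : V → ℝ) (R : ℝ) (z : ℕ → V) (k : ℕ) (x : V) :
    dualPotential f R z k x = ∑ j ∈ Finset.range k, lam j * f (z j)
      - (1 + Lam k) * (f x + inner ℝ (gradient f x) (center z k - x)) + R * ‖gradient f x‖ := by
  have h1 : (1 + Lam k) * inner ℝ (gradient f x) (center z k) =
      inner ℝ (gradient f x) (z 0) +
        ∑ j ∈ Finset.range k, lam j * inner ℝ (gradient f x) (z j) := by
    rw [← inner_smul_right, one_add_Lam_smul_center, inner_add_right, inner_sum]
    simp only [inner_smul_right]
  simp only [dualPotential, inner_sub_right, mul_sub, mul_add, Finset.sum_sub_distrib,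
    ← Finset.sum_mul, h1]
  rw [← Lam]
  ring

variable {f : V → ℝ} {R : ℝ} {z : ℕ → V} {k : ℕ}

/-- Weak duality for the `k`-th iteration. -/
theorem le_dualPotential (hc : ConvexOn ℝ Set.univ f) (hd : Differentiable ℝ f)
    {y : V} (hy : y ∈ Metric.closedBall (center z k) (R / (1 + Lam k))) (x : V) :
    ∑ j ∈ Finset.range k, lam j * f (z j) - (1 + Lam k) * f y ≤ dualPotential f R z k x := by
  rw [dualPotential_eq]
  have hΛ := one_add_Lam_pos k
  have h1 := convex_first_order hc hd x y
  rw [Metric.mem_closedBall, dist_eq_norm, norm_sub_rev, le_div_iff₀ hΛ] at hy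
  have h2 := real_inner_le_norm (gradient f x) (center z k - y)
  have e : center z k - x = (center z k - y) + (y - x) := by abel
  rw [e, inner_add_right]
  have h3 := mul_le_mul_of_nonneg_left hy (norm_nonneg (gradient f x))
  have h4 := mul_le_mul_of_nonneg_left h1 hΛ.le
  have h5 := mul_le_mul_of_nonneg_left h2 hΛ.le
  linarith

/-- Strong duality for the `k`-th iteration. -/
theorem dualPotential_le_of_isMinOn (hd : Differentiable ℝ f) (hR : 0 ≤ R) {y : V}
    (hy : y ∈ Metric.closedBall (center z k) (R / (1 + Lam k)))
    (hmin : IsMinOn f (Metric.closedBall (center z k) (R / (1 + Lam k))) y) :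
    dualPotential f R z k y ≤ ∑ j ∈ Finset.range k, lam j * f (z j) - (1 + Lam k) * f y := by
  rw [dualPotential_eq]
  have hΛ := one_add_Lam_pos k
  set g := gradient f y with hg
  set ρ := R / (1 + Lam k) with hρ
  have hρ0 : 0 ≤ ρ := by positivity
  have hR' : R = (1 + Lam k) * ρ := by rw [hρ, mul_div_cancel₀ _ hΛ.ne']
  -- This point minimizes `⟨g, ·⟩` over the ball. For `g = 0` the convention `0⁻¹ = 0` makes it the
  -- center.
  have hmem : center z k - (ρ * ‖g‖⁻¹) • g ∈ Metric.closedBall (center z k) ρ := by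
    rw [Metric.mem_closedBall, dist_eq_norm, sub_sub_cancel_left, norm_neg, norm_smul, norm_mul,
      norm_inv, norm_norm, Real.norm_of_nonneg hρ0, mul_assoc]
    exact mul_le_of_le_one_right hρ0 (inv_mul_le_one)
  have h1 := inner_gradient_nonneg_of_isMinOn hd (convex_closedBall _ _) hy hmem hmin
  have e : center z k - (ρ * ‖g‖⁻¹) • g - y = (center z k - y) - (ρ * ‖g‖⁻¹) • g := by abel
  rw [← hg, e, inner_sub_right, inner_smul_right, real_inner_self_eq_norm_sq] at h1
  have h2 : ρ * ‖g‖⁻¹ * ‖g‖ ^ 2 = ρ * ‖g‖ := by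
    rcases eq_or_ne ‖g‖ 0 with h0 | h0
    · simp [h0]
    · field_simp
  rw [h2] at h1
  have h3 := mul_nonneg hΛ.le h1
  rw [hR']
  linarith

end Potential

/-! ### The gradient bound -/

section Guarantee

variable {V : Type} [NormedAddCommGroup V] [InnerProductSpace ℝ V] [CompleteSpace V]

/-- With approximate minimizers at each iteration, the gradient at the exact minimizer of the
last subproblem is small. -/
theorem radius_mul_norm_gradient_le {f : V → ℝ} {R Δ : ℝ} {z : ℕ → V} (hc : ConvexOn ℝ Set.univ f)
    (hd : Differentiable ℝ f) (hR : 0 ≤ R) (hΔ : 0 < Δ) {y : ℕ → V}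
    (hy : ∀ k, y k ∈ Metric.closedBall (center z k) (R / (1 + Lam k)))
    (hmin : ∀ k, IsMinOn f (Metric.closedBall (center z k) (R / (1 + Lam k))) (y k))
    (hz : ∀ k, z (k + 1) ∈ epsArgmin (eps Δ (k + 1) / (1 + Lam (k + 1)))
      (Metric.closedBall (center z (k + 1)) (R / (1 + Lam (k + 1)))) f)
    {x : V} (hx : gradient f x = 0) (k : ℕ) :
    R * ‖gradient f (y (k + 1))‖ ≤ 33 / 32 * (f (z 0) - f x) + Δ / 32 := by
  -- The optimal values of the successive dual problems grow by at most `ε_k`, and the last term is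
  -- the sum of these increments.
  have key : ∀ k, ∑ j ∈ Finset.range (k + 1), lam j * f (z j) - (1 + Lam (k + 1)) * f (y (k + 1)) ≤
      - f x + (f (z 0) - f x) / 32 + Δ / 32 * (1 - (2 / 3) ^ k) := by
    intro k
    induction k with
    | zero =>
      -- The first dual problem is tested at `∇f(x) = 0`; only the weight `λ_0 = 1/32` contributes
      -- beyond `-f(x)`.
      refine (le_dualPotential hc hd (hy 1) x).trans ?_
      simp [dualPotential, hx, lam]
      linarith
    | succ k ih =>
      -- The previous dual solution is a candidate for the next problem.
      refine (le_dualPotential hc hd (hy (k + 2)) (y (k + 1))).trans ?_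
      rw [dualPotential_succ]
      have h1 := dualPotential_le_of_isMinOn hd hR (hy (k + 1)) (hmin (k + 1))
      have h2 := inner_gradient_nonneg_of_isMinOn hd (convex_closedBall _ _) (hy (k + 1))
        (hz k).1 (hmin (k + 1))
      have h3 := (hz k).2 _ (hy (k + 1))
      have h4 : lam (k + 1) * (f (z (k + 1)) - f (y (k + 1))
          - inner ℝ (gradient f (y (k + 1))) (z (k + 1) - y (k + 1))) ≤
          lam (k + 1) * (eps Δ (k + 1) / (1 + Lam (k + 1))) :=
        mul_le_mul_of_nonneg_left (by linarith) (lam_pos _).le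
      have h5 : lam (k + 1) * (eps Δ (k + 1) / (1 + Lam (k + 1))) ≤ eps Δ (k + 1) := by
        rw [mul_div_assoc', div_le_iff₀ (one_add_Lam_pos _), mul_comm]
        exact mul_le_mul_of_nonneg_left (lam_le_one_add_Lam _) (eps_pos hΔ _).le
      have h6 : eps Δ (k + 1) = Δ / 32 * ((2 / 3) ^ k - (2 / 3) ^ (k + 1)) := by
        have : ((3 : ℝ) / 2) ^ k * (2 / 3) ^ k = 1 := by rw [← mul_pow]; norm_num
        rw [eps, div_eq_iff (by positivity), pow_succ, pow_succ]
        linear_combination (-Δ) * this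
      linarith
  have h1 := (dualPotential_le_of_isMinOn hd hR (hy (k + 1)) (hmin (k + 1))).trans (key k)
  -- The Bregman terms can be dropped from below, and the tangent plane at `y (k + 1)` lies below `f
  -- (z 0)`.
  have h2 : 0 ≤ ∑ j ∈ Finset.range (k + 1), lam j * (f (z j) - f (y (k + 1))
      - inner ℝ (gradient f (y (k + 1))) (z j - y (k + 1))) :=
    Finset.sum_nonneg fun j _ => mul_nonneg (lam_pos j).le
      (by linarith [convex_first_order hc hd (y (k + 1)) (z j)])
  have h3 := convex_first_order hc hd (y (k + 1)) (z 0)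
  rw [← neg_sub, inner_neg_right] at h3
  have h4 : 0 ≤ Δ / 32 * ((2 : ℝ) / 3) ^ k := by positivity
  unfold dualPotential at h1
  linarith

/-- The gradient bound for the last iterate. -/
theorem norm_gradient_iterate_le [FiniteDimensional ℝ V] {β Δ γ : ℝ} {x₀ : V} {h : V → ℝ}
    (H : IsInstance β Δ x₀ h) (hγ : 0 < γ) (hγ' : γ < √(2 * β * Δ)) {z : ℕ → V} (hz0 : z 0 = x₀)
    (hz : ∀ k, z (k + 1) ∈ epsArgmin (eps Δ (k + 1) / (1 + Lam (k + 1)))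
      (Metric.closedBall (center z (k + 1)) (5 * Δ / γ / (1 + Lam (k + 1))))
      (regularized Δ γ x₀ h))
    {k : ℕ} (hk : 16 * √(β * Δ) / γ ≤ (3 / 2) ^ (k + 1)) :
    ‖gradient h (z (k + 1))‖ ≤ γ := by
  obtain ⟨hβ, hΔ, hγ2⟩ := H.pos hγ hγ'
  have : ProperSpace V := FiniteDimensional.proper_real V
  set f := regularized Δ γ x₀ h with hf
  have hd : Differentiable ℝ f := differentiable_regularized H.differentiable
  have hc : ConvexOn ℝ Set.univ f := convexOn_regularized hΔ H.convex
  have hs := smooth_regularized (x₀ := x₀) hΔ hγ2.le H.differentiable H.smooth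
  have hR : 0 < 5 * Δ / γ := by positivity
  have hex : ∀ k, ∃ y ∈ Metric.closedBall (center z k) (5 * Δ / γ / (1 + Lam k)),
      IsMinOn f (Metric.closedBall (center z k) (5 * Δ / γ / (1 + Lam k))) y := fun k =>
    (isCompact_closedBall _ _).exists_isMinOn
      ⟨_, Metric.mem_closedBall_self (div_nonneg hR.le (one_add_Lam_pos k).le)⟩
      hd.continuous.continuousOn
  choose y hy hmin using hex
  obtain ⟨x, hx⟩ := exists_isMinOn_regularized H hγ hΔ
  have hx0 : gradient f x = 0 := by
    have : fderiv ℝ f x = 0 := IsLocalMin.fderiv_eq_zero (Filter.Eventually.of_forall hx)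
    rw [gradient, this, map_zero]
  have h1 := radius_mul_norm_gradient_le hc hd hR.le hΔ hy hmin hz hx0 k
  have hfx : f x = h x + γ ^ 2 / (16 * Δ) * ‖x - x₀‖ ^ 2 := rfl
  have hfx0 : f x₀ = h x₀ := regularized_self
  have hgap := H.sub_le x
  have hσ : 0 < γ ^ 2 / (16 * Δ) := by positivity
  set σ := γ ^ 2 / (16 * Δ) with hσdef
  have hσ2 : γ ^ 2 / (8 * Δ) = 2 * σ := by rw [hσdef]; field_simp; ring
  have hσΔ : σ * Δ = γ ^ 2 / 16 := by rw [hσdef]; field_simp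
  -- The constant is `(34 / 32) / 5`, from `R = 5 Δ / γ`. The final budget is `2 · 0.2825 + 0.36 <
  -- 1`.
  have hyb : ‖gradient f (y (k + 1))‖ ≤ 2125 / 10000 * γ := by
    rw [hz0, hfx0] at h1
    have h2 : 5 * Δ / γ * ‖gradient f (y (k + 1))‖ ≤ 34 / 32 * Δ := by
      nlinarith [sq_nonneg ‖x - x₀‖]
    rw [div_mul_eq_mul_div, div_le_iff₀ hγ] at h2
    have h3 : Δ * ‖gradient f (y (k + 1))‖ ≤ Δ * (2125 / 10000 * γ) := by linarith
    exact le_of_mul_le_mul_left h3 hΔ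
  -- Co-coercivity with constant `5 β / 4` gives `(5 / 2) γ² / 512 < (0.07 γ)²`. The variational
  -- inequality at `y (k + 1)` bounds the Bregman divergence by the accuracy.
  have hdiff : ‖gradient f (z (k + 1)) - gradient f (y (k + 1))‖ ≤ 7 / 100 * γ := by
    refine le_of_sq_le_sq ?_ (by positivity)
    refine (norm_gradient_sub_sq_le (by positivity : 0 < 5 / 4 * β) hc hd hs _ _).trans ?_
    have h2 := inner_gradient_nonneg_of_isMinOn hd (convex_closedBall _ _) (hy (k + 1))
      (hz k).1 (hmin (k + 1))
    have h3 := (hz k).2 _ (hy (k + 1))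
    have h4 : eps Δ (k + 1) / (1 + Lam (k + 1)) * β ≤ γ ^ 2 / 512 := by
      rw [Lam_eq, eps]
      have h5 : (16 * √(β * Δ) / γ) ^ 2 ≤ ((3 / 2) ^ (k + 1)) ^ 2 := by gcongr
      rw [div_pow, mul_pow, Real.sq_sqrt (by positivity), div_le_iff₀ (by positivity)] at h5
      set p : ℝ := (3 / 2) ^ (k + 1) with hp
      have hp1 : 0 < p := by positivity
      have hpq : p ≤ 2 ^ (k + 1) := by rw [hp]; gcongr; norm_num
      set q : ℝ := 2 ^ (k + 1)
      have hq : 0 < 1 + (q - 1) / 32 := by linarith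
      rw [div_div, div_mul_eq_mul_div, div_le_iff₀ (by positivity)]
      have h6 : p * p * γ ^ 2 ≤ p * (31 + q) * γ ^ 2 := by gcongr; linarith
      nlinarith
    have h7 : f (z (k + 1)) - f (y (k + 1)) - inner ℝ (gradient f (y (k + 1)))
        (z (k + 1) - y (k + 1)) ≤ eps Δ (k + 1) / (1 + Lam (k + 1)) := by linarith
    have h8 := mul_le_mul_of_nonneg_left h7 hβ.le
    nlinarith
  have hzb : ‖gradient f (z (k + 1))‖ ≤ 2825 / 10000 * γ := by
    have := norm_le_norm_add_norm_sub (gradient f (y (k + 1))) (gradient f (z (k + 1)))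
    rw [norm_sub_rev] at this
    linarith
  have hstr := regularized_strong_first_order (γ := γ) (x₀ := x₀) hΔ H.convex H.differentiable
  rw [← hf, ← hσdef] at hstr
  have hzx : 2 * σ * ‖z (k + 1) - x‖ ≤ 2825 / 10000 * γ := by
    rcases (norm_nonneg (z (k + 1) - x)).eq_or_lt with h0 | h0
    · rw [← h0, mul_zero]; positivity
    refine le_trans (le_of_mul_le_mul_right ?_ h0) hzb
    have h2 := hstr x (z (k + 1))
    have h3 := hstr (z (k + 1)) x
    rw [hx0, inner_zero_left] at h2
    rw [← neg_sub, inner_neg_right, norm_neg] at h3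
    have h4 := real_inner_le_norm (gradient f (z (k + 1))) (z (k + 1) - x)
    nlinarith
  -- The term `σ‖x - x₀‖²` is gained twice, from the value of `f x` and from strong convexity. Hence
  -- `(2 σ ‖x - x₀‖)² ≤ 2 σ Δ = γ² / 8`.
  have hxx : 2 * σ * ‖x - x₀‖ ≤ 36 / 100 * γ := by
    refine le_of_sq_le_sq ?_ (by positivity)
    have h2 := hstr x x₀
    rw [hx0, inner_zero_left, norm_sub_rev x₀ x] at h2
    have h3 : 2 * σ * ‖x - x₀‖ ^ 2 ≤ Δ := by linarith
    have h4 := mul_le_mul_of_nonneg_left h3 hσ.le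
    nlinarith [sq_nonneg γ]
  have hgrad : gradient h (z (k + 1)) =
      gradient f (z (k + 1)) - (2 * σ) • ((z (k + 1) - x) + (x - x₀)) := by
    rw [hf, gradient_regularized H.differentiable, hσ2, sub_add_sub_cancel, add_sub_cancel_right]
  rw [hgrad, smul_add]
  have e1 := norm_sub_le (gradient f (z (k + 1))) ((2 * σ) • (z (k + 1) - x) + (2 * σ) • (x - x₀))
  have e2 := norm_add_le ((2 * σ) • (z (k + 1) - x)) ((2 * σ) • (x - x₀))
  rw [norm_smul, norm_smul, Real.norm_of_nonneg (by positivity)] at e2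
  linarith

end Guarantee

/-! ### Iterates and query count of the algorithm -/

section Algorithm

variable {V : Type} [NormedAddCommGroup V] [InnerProductSpace ℝ V]

theorem run_iterates_apply_of_le (G : V → V) (Δ γ : ℝ) (x₀ : V)
    (cgm : ℝ → V → ℝ → Procedure V V) {j k : ℕ} (hjk : j ≤ k) :
    (iterates Δ γ x₀ cgm k).run G j = (iterates Δ γ x₀ cgm j).run G j := by
  induction k, hjk using Nat.le_induction with
  | base => rfl
  | succ k hk ih =>
    rw [← ih]
    simp only [iterates, Procedure.run_bind, Procedure.run]
    exact Function.update_of_ne (by omega) _ _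

variable [CompleteSpace V]

/-- Later iterations never overwrite earlier entries, so the diagonal sequence `z` contains all
iterates at once and does not depend on `K`. -/
theorem run_iterates_succ_mem {β Δ γ c : ℝ} {f : V → ℝ} {x₀ : V}
    {cgm : ℝ → V → ℝ → Procedure V V} (hγ : 0 < γ) (hΔ : 0 < Δ) (hcgm : IsCGM β c f cgm) (k : ℕ) :
    let z := fun j => (iterates Δ γ x₀ cgm j).run (gradient f) j
    z (k + 1) ∈ epsArgmin (eps Δ (k + 1) / (1 + Lam (k + 1)))
      (Metric.closedBall (center z (k + 1)) (5 * Δ / γ / (1 + Lam (k + 1)))) f := by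
  intro z
  have hcen : center z (k + 1) = center ((iterates Δ γ x₀ cgm k).run (gradient f)) (k + 1) :=
    center_congr k.succ_pos fun j hj =>
      (run_iterates_apply_of_le _ _ _ _ _ (Nat.lt_succ_iff.1 hj)).symm
  have hz : z (k + 1) = (cgm (5 * Δ / γ / (1 + Lam (k + 1))) (center z (k + 1))
      (eps Δ (k + 1) / (1 + Lam (k + 1)))).run (gradient f) := by
    rw [hcen]
    simp [z, iterates, Procedure.run]
  rw [hz]
  have := one_add_Lam_pos (k + 1)
  have := eps_pos hΔ (k + 1)
  exact (hcgm _ _ _ (by positivity) (by positivity)).1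

/-- The `1` in the oracle bound contributes `k`; the square roots contribute the geometric sum of
`(87 / 100) ^ i` over `1 ≤ i ≤ k`. -/
theorem numQueries_iterates_le {β Δ γ c : ℝ} {f : V → ℝ} {x₀ : V}
    {cgm : ℝ → V → ℝ → Procedure V V} (hγ : 0 < γ) (hΔ : 0 < Δ) (hβ : 0 < β)
    (hcgm : IsCGM β c f cgm) (k : ℕ) :
    ((iterates Δ γ x₀ cgm k).numQueries (gradient f) : ℝ) ≤
      |c| * (k + 227 * (√(β * Δ) / γ) * (87 / 13 * (1 - (87 / 100) ^ k))) := by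
  induction k with
  | zero => simp [iterates, Procedure.numQueries]
  | succ k ih =>
    simp only [iterates, Procedure.numQueries_bind, Procedure.numQueries, add_zero, Nat.cast_add]
    have hΛ := one_add_Lam_pos (k + 1)
    have he := eps_pos hΔ (k + 1)
    have h1 := (hcgm (5 * Δ / γ / (1 + Lam (k + 1)))
      (center ((iterates Δ γ x₀ cgm k).run (gradient f)) (k + 1))
      (eps Δ (k + 1) / (1 + Lam (k + 1))) (by positivity) (by positivity)).2
    -- The radicand is `25 β Δ² / γ²` over `(1 + Λ) ε ≥ (Δ / 2048) (4 / 3) ^ (k + 1)`. The constants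
    -- round up `√(25 · 2048)` and `√(3 / 4)`.
    have h2 : √(β * (5 * Δ / γ / (1 + Lam (k + 1))) ^ 2 / (eps Δ (k + 1) / (1 + Lam (k + 1)))) ≤
        227 * (√(β * Δ) / γ) * (87 / 100) ^ (k + 1) := by
      refine Real.sqrt_le_iff.2 ⟨by positivity, ?_⟩
      rw [mul_pow, mul_pow, div_pow √(β * Δ), Real.sq_sqrt (by positivity)]
      have e1 : β * (5 * Δ / γ / (1 + Lam (k + 1))) ^ 2 / (eps Δ (k + 1) / (1 + Lam (k + 1))) =
          25 * β * Δ ^ 2 / γ ^ 2 / ((1 + Lam (k + 1)) * eps Δ (k + 1)) := by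
        field_simp
        ring
      rw [e1, div_le_iff₀ (by positivity)]
      have e2 : Δ / 2048 * (4 / 3) ^ (k + 1) ≤ (1 + Lam (k + 1)) * eps Δ (k + 1) := by
        have h3 : lam (k + 1) * eps Δ (k + 1) = Δ / 2048 * (4 / 3) ^ (k + 1) := by
          rw [show (4 / 3 : ℝ) = 2 / (3 / 2) by norm_num, div_pow 2, lam, eps]
          field_simp
          ring
        rw [← h3]
        exact mul_le_mul_of_nonneg_right (lam_le_one_add_Lam _) he.le
      have e3 : (1 : ℝ) ≤ ((87 / 100) ^ (k + 1)) ^ 2 * (4 / 3) ^ (k + 1) := by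
        rw [← pow_mul, mul_comm (k + 1) 2, pow_mul, ← mul_pow]
        exact one_le_pow₀ (by norm_num)
      calc 25 * β * Δ ^ 2 / γ ^ 2 ≤ 227 ^ 2 * (β * Δ / γ ^ 2) * (Δ / 2048) * 1 := by
            have : 0 ≤ β * Δ ^ 2 / γ ^ 2 := by positivity
            have e : 227 ^ 2 * (β * Δ / γ ^ 2) * (Δ / 2048) * 1 =
              227 ^ 2 / 2048 * (β * Δ ^ 2 / γ ^ 2) := by ring
            rw [e, mul_assoc, mul_div_assoc]
            gcongr
            norm_num
        _ ≤ 227 ^ 2 * (β * Δ / γ ^ 2) * (Δ / 2048) *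
            (((87 / 100) ^ (k + 1)) ^ 2 * (4 / 3) ^ (k + 1)) := by gcongr
        _ = 227 ^ 2 * (β * Δ / γ ^ 2) * ((87 / 100) ^ (k + 1)) ^ 2 *
            (Δ / 2048 * (4 / 3) ^ (k + 1)) := by ring
        _ ≤ _ := by gcongr
    have h3 := h1.trans ((mul_le_mul_of_nonneg_right (le_abs_self c) (by positivity)).trans
      (mul_le_mul_of_nonneg_left (add_le_add_right h2 1) (abs_nonneg c)))
    refine (add_le_add ih h3).trans (le_of_eq ?_)
    rw [pow_succ]
    push_cast
    ring

end Algorithm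

theorem le_pow_of_iterationCount_le {β Δ γ : ℝ} (hβ : 0 < β) (hΔ : 0 < Δ) (hγ : 0 < γ) {K : ℕ}
    (hK : iterationCount β Δ γ ≤ K) : 16 * √(β * Δ) / γ ≤ (3 / 2) ^ K := by
  rw [iterationCount, Nat.ceil_le, Real.logb_le_iff_le_rpow (by norm_num) (by positivity)] at hK
  exact_mod_cast hK

/-- A logarithm is at most linear, so the one query per iteration that the oracle bound always
allows is absorbed. -/
theorem iterationCount_le {β Δ γ : ℝ} (h : 1 / 2 ≤ √(β * Δ) / γ) :
    (iterationCount β Δ γ : ℝ) ≤ 50 * (√(β * Δ) / γ) := by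
  set r := √(β * Δ) / γ with hr
  have e : 16 * √(β * Δ) / γ = 16 * r := by rw [hr, mul_div_assoc]
  have h1 : 0 ≤ Real.log (16 * r) := Real.log_nonneg (by linarith)
  have h2 := Real.log_le_sub_one_of_pos (by linarith : 0 < 16 * r)
  have h3 : (1 : ℝ) / 3 ≤ Real.log (3 / 2) := by
    have := Real.one_sub_inv_le_log_of_pos (by norm_num : (0 : ℝ) < 3 / 2)
    norm_num at this ⊢
    exact this
  have h4 : Real.logb (3 / 2) (16 * r) ≤ 48 * r - 3 := by
    rw [Real.logb, div_le_iff₀ (by linarith)]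
    nlinarith
  have h5 : 0 ≤ Real.logb (3 / 2) (16 * r) := div_nonneg h1 (by linarith)
  rw [iterationCount, e]
  linarith [Nat.ceil_lt_add_one h5]

theorem algorithm_guarantee (c A : ℝ) : ∃ C : ℝ, 0 < C ∧
    ∀ (V : Type) [NormedAddCommGroup V] [InnerProductSpace ℝ V] [CompleteSpace V]
      [FiniteDimensional ℝ V] (β Δ γ : ℝ) (x₀ : V) (h : V → ℝ),
      IsInstance β Δ x₀ h → 0 < γ → γ < √(2 * β * Δ) →
      ∀ cgm : ℝ → V → ℝ → Procedure V V, IsCGM β c (regularized Δ γ x₀ h) cgm →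
        ∀ K : ℕ, iterationCount β Δ γ ≤ K → (K : ℝ) ≤ A * iterationCount β Δ γ →
          ‖gradient h ((algorithm Δ γ x₀ cgm K).run (gradient h))‖ ≤ γ ∧
          ((algorithm Δ γ x₀ cgm K).numQueries (gradient h) : ℝ) ≤ C * (√(β * Δ) / γ) := by
  -- Here `1600` exceeds `227 · 87 / 13`, and `+ 1` keeps the constant positive when `c = 0`.
  refine ⟨|c| * (50 * |A| + 1600) + 1, by positivity, ?_⟩
  intro V _ _ _ _ β Δ γ x₀ h H hγ hγ' cgm hcgm K hK hKA
  obtain ⟨hβ, hΔ, hγ2⟩ := H.pos hγ hγ'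
  have hr : 1 / 2 ≤ √(β * Δ) / γ := by
    rw [le_div_iff₀ hγ]
    refine Real.le_sqrt_of_sq_le ?_
    nlinarith
  have hpow := le_pow_of_iterationCount_le hβ hΔ hγ hK
  rw [algorithm, Procedure.run_translate, Procedure.numQueries_translate,
    ← gradient_regularized H.differentiable]
  constructor
  -- `K = 0` is impossible because `16 √(β Δ) / γ ≥ 8 > 1`.
  · obtain ⟨k, rfl⟩ : ∃ k, K = k + 1 := by
      refine Nat.exists_eq_succ_of_ne_zero ?_
      rintro rfl
      rw [pow_zero, mul_div_assoc] at hpow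
      linarith
    rw [Procedure.run_bind, Procedure.run]
    exact norm_gradient_iterate_le H hγ hγ' rfl (run_iterates_succ_mem hγ hΔ hcgm) hpow
  · rw [Procedure.numQueries_bind, Procedure.numQueries, add_zero]
    refine (numQueries_iterates_le hγ hΔ hβ hcgm K).trans ?_
    set r := √(β * Δ) / γ with hrdef
    have h1 : (K : ℝ) ≤ |A| * (50 * r) :=
      hKA.trans (mul_le_mul (le_abs_self A) (iterationCount_le hr)
        (Nat.cast_nonneg _) (abs_nonneg A))
    have h2 : 0 ≤ ((87 : ℝ) / 100) ^ K := by positivity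
    have h3 : 227 * r * (87 / 13 * (1 - (87 / 100) ^ K)) ≤ 1600 * r := by nlinarith
    have h4 := mul_le_mul_of_nonneg_left (add_le_add h1 h3) (abs_nonneg c)
    linarith

/-! ### The accelerated projected gradient method as an oracle -/

section Accelerated

variable {V : Type} [NormedAddCommGroup V] [InnerProductSpace ℝ V]

/-- `m` steps of the accelerated projected gradient method, started at step `k`. -/
noncomputable def acceleratedGradient (L : ℝ) (proj : V → V) : ℕ → ℕ → V → V → Procedure V V
  | 0, _, x, _ => .done x
  | m + 1, k, x, v =>
    .query ((k / (k + 2) : ℝ) • x + (2 / (k + 2) : ℝ) • v) fun g =>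
      acceleratedGradient L proj m (k + 1)
        ((k / (k + 2) : ℝ) • x + (2 / (k + 2) : ℝ) • proj (v - ((k + 1) / (2 * L)) • g))
        (proj (v - ((k + 1) / (2 * L)) • g))

theorem numQueries_acceleratedGradient (G : V → V) (L : ℝ) (proj : V → V) (m k : ℕ) (x v : V) :
    (acceleratedGradient L proj m k x v).numQueries G = m := by
  induction m generalizing k x v with
  | zero => rfl
  | succ m ih => simp only [acceleratedGradient, Procedure.numQueries, ih]

/-- One step of the accelerated projected gradient method decreases its potential. -/
theorem accelerated_step [CompleteSpace V] {f : V → ℝ} {L : ℝ} (hL : 0 < L)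
    (hc : ConvexOn ℝ Set.univ f) (hd : Differentiable ℝ f)
    (hs : ∀ u v : V, ‖gradient f u - gradient f v‖ ≤ L * ‖u - v‖) (k : ℕ) {x v y v' x' u : V}
    (hy : y = (k / (k + 2) : ℝ) • x + (2 / (k + 2) : ℝ) • v)
    (hx' : x' = (k / (k + 2) : ℝ) • x + (2 / (k + 2) : ℝ) • v')
    (hv' : inner ℝ (v - ((k + 1) / (2 * L)) • gradient f y - v') (u - v') ≤ 0) :
    (k + 1) * (k + 2) / 4 * (f x' - f u) + L / 2 * ‖u - v'‖ ^ 2 ≤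
      k * (k + 1) / 4 * (f x - f u) + L / 2 * ‖u - v‖ ^ 2 := by
  have hk : (0 : ℝ) ≤ k := Nat.cast_nonneg k
  set g := gradient f y with hg
  have h1 := smooth_upper_bound hd hs y x'
  have h2 := convex_first_order hc hd y x
  have h3 := convex_first_order hc hd y u
  rw [← hg] at h1 h2 h3
  have e1 : x' - y = (2 / (k + 2) : ℝ) • (v' - v) := by rw [hx', hy, smul_sub]; abel
  have e2 : ‖x' - y‖ ^ 2 = (2 / (k + 2)) ^ 2 * ‖v' - v‖ ^ 2 := by
    rw [e1, norm_smul, Real.norm_of_nonneg (by positivity), mul_pow]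
  -- With `A_k = k (k + 1) / 4` the averaging weights are `A_k / A_{k+1}` and `(A_{k+1} - A_k) /
  -- A_{k+1}`, so the linear terms split exactly.
  have e3 : ((k + 1) * (k + 2) / 4 : ℝ) * inner ℝ g (x' - y) =
      k * (k + 1) / 4 * inner ℝ g (x - y) + (k + 1) / 2 * inner ℝ g (v' - y) := by
    have : ((k + 1) * (k + 2) / 4 : ℝ) • (x' - y) =
        (k * (k + 1) / 4 : ℝ) • (x - y) + ((k + 1) / 2 : ℝ) • (v' - y) := by
      rw [hx']
      match_scalars <;> field_simp <;> ring
    rw [← inner_smul_right, this, inner_add_right, inner_smul_right, inner_smul_right]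
  have e4 : inner ℝ g (v' - y) = inner ℝ g (u - y) - inner ℝ g (u - v') := by
    rw [← inner_sub_right]; congr 1; abel
  have e5 : ‖u - v‖ ^ 2 = ‖u - v'‖ ^ 2 - 2 * inner ℝ (v - v') (u - v') + ‖v' - v‖ ^ 2 := by
    rw [show u - v = (u - v') - (v - v') by abel, norm_sub_sq_real, real_inner_comm (u - v'),
      norm_sub_rev v v']
  have h4 : L * inner ℝ (v - v') (u - v') ≤ (k + 1) / 2 * inner ℝ g (u - v') := by
    have e : v - ((k + 1) / (2 * L)) • g - v' = (v - v') - ((k + 1) / (2 * L)) • g := by abel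
    rw [e, inner_sub_left, inner_smul_left, conj_trivial] at hv'
    have := mul_le_mul_of_nonneg_left hv' hL.le
    have e' : L * ((k + 1) / (2 * L) * inner ℝ g (u - v')) = (k + 1) / 2 * inner ℝ g (u - v') := by
      field_simp
    linarith
  -- The smoothness error is paid for by the movement of `v`, since `A_{k+1} (2 / (k + 2))² ≤ 1`.
  have h5 : (k + 1) * (k + 2) / 4 * (L / 2 * ‖x' - y‖ ^ 2) ≤ L / 2 * ‖v' - v‖ ^ 2 := by
    have : ((k + 1) * (k + 2) / 4 * (2 / (k + 2)) ^ 2 : ℝ) ≤ 1 := by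
      rw [div_pow, div_mul_div_comm, div_le_one (by positivity)]
      nlinarith
    rw [e2]
    have := mul_le_mul_of_nonneg_right this (by positivity : 0 ≤ L / 2 * ‖v' - v‖ ^ 2)
    linarith
  have h6 := mul_le_mul_of_nonneg_left h1 (by positivity : (0 : ℝ) ≤ (k + 1) * (k + 2) / 4)
  have h7 := mul_le_mul_of_nonneg_left h2 (by positivity : (0 : ℝ) ≤ k * (k + 1) / 4)
  have h8 := mul_le_mul_of_nonneg_left h3 (by positivity : (0 : ℝ) ≤ (k + 1) / 2)
  rw [e4] at e3
  rw [e5]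
  linarith

theorem run_acceleratedGradient [CompleteSpace V] {f : V → ℝ} {L : ℝ} (hL : 0 < L)
    (hc : ConvexOn ℝ Set.univ f) (hd : Differentiable ℝ f)
    (hs : ∀ u v : V, ‖gradient f u - gradient f v‖ ≤ L * ‖u - v‖) {B : Set V} (hB : Convex ℝ B)
    {proj : V → V} (hproj : ∀ p, proj p ∈ B ∧ ∀ u ∈ B, inner ℝ (p - proj p) (u - proj p) ≤ 0)
    (m k : ℕ) {x v : V} (hx : x ∈ B) :
    (acceleratedGradient L proj m k x v).run (gradient f) ∈ B ∧
    ∀ u ∈ B, ((k + m : ℕ) : ℝ) * ((k + m : ℕ) + 1) / 4 *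
      (f ((acceleratedGradient L proj m k x v).run (gradient f)) - f u) ≤
        k * (k + 1) / 4 * (f x - f u) + L / 2 * ‖u - v‖ ^ 2 := by
  induction m generalizing k x v with
  | zero =>
    refine ⟨hx, fun u _ => ?_⟩
    simp only [acceleratedGradient, Procedure.run, add_zero]
    have : 0 ≤ L / 2 * ‖u - v‖ ^ 2 := by positivity
    linarith
  | succ m ih =>
    simp only [acceleratedGradient, Procedure.run]
    set y := (k / (k + 2) : ℝ) • x + (2 / (k + 2) : ℝ) • v with hy
    set v' := proj (v - ((k + 1) / (2 * L)) • gradient f y) with hv'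
    have hx' : (k / (k + 2) : ℝ) • x + (2 / (k + 2) : ℝ) • v' ∈ B :=
      hB hx (hproj _).1 (by positivity) (by positivity) (by field_simp)
    obtain ⟨h1, h2⟩ := ih (k + 1) (v := v') hx'
    refine ⟨h1, fun u hu => ?_⟩
    have h3 := h2 u hu
    have h4 := accelerated_step hL hc hd hs k hy rfl ((hproj _).2 u hu)
    rw [show k + (m + 1) = k + 1 + m by ring]
    push_cast at h3 ⊢
    linarith

theorem exists_proj_closedBall [CompleteSpace V] (w : V) {ζ : ℝ} (hζ : 0 < ζ) :
    ∃ proj : V → V, ∀ p, proj p ∈ Metric.closedBall w ζ ∧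
      ∀ u ∈ Metric.closedBall w ζ, inner ℝ (p - proj p) (u - proj p) ≤ 0 := by
  have : ∀ p, ∃ q, q ∈ Metric.closedBall w ζ ∧
      ∀ u ∈ Metric.closedBall w ζ, inner ℝ (p - q) (u - q) ≤ 0 := by
    intro p
    obtain ⟨q, hq, h⟩ := exists_norm_eq_iInf_of_complete_convex
      ⟨w, Metric.mem_closedBall_self hζ.le⟩ (Metric.isClosed_closedBall (x := w) (ε := ζ)).isComplete
      (convex_closedBall w ζ) p
    exact ⟨q, hq, (norm_eq_iInf_iff_real_inner_le_zero (convex_closedBall w ζ) hq).1 h⟩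
  choose proj hproj using this
  exact ⟨proj, hproj⟩

/-- The accelerated projected gradient method gives an oracle for all instances at once. -/
theorem exists_isCGM [CompleteSpace V] {β Δ γ : ℝ} {x₀ : V} (hγ : 0 < γ)
    (hγ' : γ < √(2 * β * Δ)) : ∃ cgm : ℝ → V → ℝ → Procedure V V,
      ∀ h : V → ℝ, IsInstance β Δ x₀ h → IsCGM β 2 (regularized Δ γ x₀ h) cgm := by
  have hex : ∀ (ζ : ℝ) (w : V), ∃ proj : V → V, 0 < ζ → ∀ p, proj p ∈ Metric.closedBall w ζ ∧
      ∀ u ∈ Metric.closedBall w ζ, inner ℝ (p - proj p) (u - proj p) ≤ 0 := by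
    intro ζ w
    by_cases hζ : 0 < ζ
    · obtain ⟨proj, hproj⟩ := exists_proj_closedBall w hζ
      exact ⟨proj, fun _ => hproj⟩
    · exact ⟨id, fun h => absurd h hζ⟩
  choose proj hproj using hex
  -- Started at `k = 0` the potential is only `(5 β / 8) ‖u - w‖²`, so `N ≥ 2 s` steps give error at
  -- most `(5 / 8) ε`, and `N ≤ 2 (1 + s)`.
  refine ⟨fun ζ w ε => acceleratedGradient (5 / 4 * β) (proj ζ w)
    (⌈2 * √(β * ζ ^ 2 / ε)⌉₊ + 1) 0 w w, fun h H ζ w ε hζ hε => ?_⟩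
  obtain ⟨hβ, hΔ, hγ2⟩ := H.pos hγ hγ'
  set s := √(β * ζ ^ 2 / ε) with hs
  have hs0 : 0 ≤ s := Real.sqrt_nonneg _
  set N := ⌈2 * s⌉₊ + 1 with hN
  have hN1 : 2 * s ≤ N := (Nat.le_ceil _).trans (by rw [hN]; exact_mod_cast Nat.le_succ _)
  constructor
  · obtain ⟨h1, h2⟩ := run_acceleratedGradient (by positivity : 0 < 5 / 4 * β)
      (convexOn_regularized hΔ H.convex) (differentiable_regularized H.differentiable)
      (smooth_regularized (x₀ := x₀) hΔ hγ2.le H.differentiable H.smooth)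
      (convex_closedBall w ζ) (hproj ζ w hζ) N 0 (v := w) (Metric.mem_closedBall_self hζ.le)
    refine ⟨h1, fun u hu => ?_⟩
    have h3 := h2 u hu
    set r := (acceleratedGradient (5 / 4 * β) (proj ζ w) N 0 w w).run
      (gradient (regularized Δ γ x₀ h))
    rw [Metric.mem_closedBall, dist_eq_norm] at hu
    have h4 : ‖u - w‖ ^ 2 ≤ ζ ^ 2 := by gcongr
    have h5 : s ^ 2 * ε = β * ζ ^ 2 := by
      rw [hs, Real.sq_sqrt (by positivity), div_mul_cancel₀ _ hε.ne']
    have hNpos : (0 : ℝ) < N := by rw [hN]; positivity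
    have h6 : (2 * s) ^ 2 ≤ N * (N + 1) := by nlinarith
    have h7 := mul_le_mul_of_nonneg_left h4 hβ.le
    have h8 := mul_le_mul_of_nonneg_right h6 hε.le
    rw [zero_add, Nat.cast_zero, zero_mul, zero_div, zero_mul, zero_add] at h3
    by_contra hcon
    have h9 : ε < regularized Δ γ x₀ h r - regularized Δ γ x₀ h u := by linarith
    have h10 := mul_lt_mul_of_pos_left h9 (by positivity : (0 : ℝ) < N * (N + 1) / 4)
    nlinarith [mul_pos hβ (pow_pos hζ 2)]
  · rw [numQueries_acceleratedGradient, ← hs]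
    have := Nat.ceil_lt_add_one (by positivity : 0 ≤ 2 * s)
    push_cast
    linarith

end Accelerated

/-! ### The lower bound: spring chains and a resisting oracle -/

section LowerBound

variable {V : Type} [NormedAddCommGroup V] [InnerProductSpace ℝ V]

/-- The first `m` vectors of the sequence `u` are orthonormal. -/
def OrthonormalBelow (u : ℕ → V) (m : ℕ) : Prop :=
  ∀ i < m, ∀ j < m, inner ℝ (u i) (u j) = if i = j then (1 : ℝ) else 0

theorem OrthonormalBelow.inner_sum {u : ℕ → V} {m i : ℕ} (hu : OrthonormalBelow u m) (hi : i < m)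
    (c : ℕ → ℝ) : inner ℝ (u i) (∑ j ∈ Finset.range m, c j • u j) = c i := by
  rw [_root_.inner_sum, Finset.sum_eq_single i]
  · rw [inner_smul_right, hu i hi i hi, if_pos rfl, mul_one]
  · intro j hj hji
    rw [inner_smul_right, hu i hi j (Finset.mem_range.1 hj), if_neg hji.symm, mul_zero]
  · exact fun h => absurd (Finset.mem_range.2 hi) h

theorem OrthonormalBelow.norm_sum_sq {u : ℕ → V} {m : ℕ} (hu : OrthonormalBelow u m) (c : ℕ → ℝ) :
    ‖∑ j ∈ Finset.range m, c j • u j‖ ^ 2 = ∑ j ∈ Finset.range m, c j ^ 2 := by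
  rw [← real_inner_self_eq_norm_sq, sum_inner]
  refine Finset.sum_congr rfl fun i hi => ?_
  rw [inner_smul_left, hu.inner_sum (Finset.mem_range.1 hi), conj_trivial, sq]

theorem OrthonormalBelow.sum_inner_sq_le {u : ℕ → V} {m : ℕ} (hu : OrthonormalBelow u m) (d : V) :
    ∑ j ∈ Finset.range m, inner ℝ (u j) d ^ 2 ≤ ‖d‖ ^ 2 := by
  have h := hu.norm_sum_sq (fun j => inner ℝ (u j) d)
  have h1 := norm_sub_sq_real d (∑ j ∈ Finset.range m, inner ℝ (u j) d • u j)
  have h2 : inner ℝ d (∑ j ∈ Finset.range m, inner ℝ (u j) d • u j) =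
      ∑ j ∈ Finset.range m, inner ℝ (u j) d ^ 2 := by
    rw [_root_.inner_sum]
    refine Finset.sum_congr rfl fun i _ => ?_
    rw [inner_smul_right, real_inner_comm, sq]
  nlinarith [sq_nonneg ‖d - ∑ j ∈ Finset.range m, inner ℝ (u j) d • u j‖]

theorem OrthonormalBelow.mono {u : ℕ → V} {m m' : ℕ} (hu : OrthonormalBelow u m) (h : m' ≤ m) :
    OrthonormalBelow u m' :=
  fun i hi j hj => hu i (hi.trans_le h) j (hj.trans_le h)

theorem OrthonormalBelow.shift {u : ℕ → V} {m : ℕ} (hu : OrthonormalBelow u (m + 1)) :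
    OrthonormalBelow (fun i => u (i + 1)) m := fun i hi j hj => by
  simpa using hu (i + 1) (by omega) (j + 1) (by omega)

/-- The worst-case quadratic: a chain of `M` springs along the directions `u 0, …, u M`, whose
first end is attached to level `a`. -/
noncomputable def chainFun (κ₀ κ a : ℝ) (M : ℕ) (x₀ : V) (u : ℕ → V) (x : V) : ℝ :=
  κ₀ / 2 * (inner ℝ (u 0) (x - x₀) - a) ^ 2 +
    ∑ i ∈ Finset.range M, κ / 2 * (inner ℝ (u i - u (i + 1)) (x - x₀) - 0) ^ 2

/-- The gradient of `chainFun`. -/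
noncomputable def chainGrad (κ₀ κ a : ℝ) (M : ℕ) (x₀ : V) (u : ℕ → V) (x : V) : V :=
  (κ₀ * (inner ℝ (u 0) (x - x₀) - a)) • u 0 +
    ∑ i ∈ Finset.range M, (κ * (inner ℝ (u i - u (i + 1)) (x - x₀) - 0)) • (u i - u (i + 1))

theorem convexOn_affine_sq {c : ℝ} (hc : 0 ≤ c) (a : ℝ) (b x₀ : V) :
    ConvexOn ℝ Set.univ (fun x => c / 2 * (inner ℝ b (x - x₀) - a) ^ 2) := by
  refine ⟨convex_univ, fun x _ y _ p q hp hq hpq => ?_⟩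
  have e : inner ℝ b (p • x + q • y - x₀) - a =
      p * (inner ℝ b (x - x₀) - a) + q * (inner ℝ b (y - x₀) - a) := by
    simp only [inner_sub_right, inner_add_right, inner_smul_right]
    linear_combination (inner ℝ b x₀ + a) * hpq
  simp only [e, smul_eq_mul]
  set s := inner ℝ b (x - x₀) - a
  set t := inner ℝ b (y - x₀) - a
  have h1 : (p * s + q * t) ^ 2 ≤ p * s ^ 2 + q * t ^ 2 := by
    obtain rfl : q = 1 - p := by linarith
    nlinarith [mul_nonneg (mul_nonneg hp hq) (sq_nonneg (s - t))]
  nlinarith [mul_le_mul_of_nonneg_left h1 hc]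

theorem convexOn_chainFun {κ₀ κ : ℝ} (hκ₀ : 0 ≤ κ₀) (hκ : 0 ≤ κ) (a : ℝ) (M : ℕ) (x₀ : V)
    (u : ℕ → V) : ConvexOn ℝ Set.univ (chainFun κ₀ κ a M x₀ u) := by
  refine (convexOn_affine_sq hκ₀ a (u 0) x₀).add ?_
  induction M with
  | zero => simpa using convexOn_const (0 : ℝ) convex_univ
  | succ M ih =>
    simp only [Finset.sum_range_succ]
    exact ih.add (convexOn_affine_sq hκ 0 (u M - u (M + 1)) x₀)

theorem chainFun_nonneg {κ₀ κ : ℝ} (hκ₀ : 0 ≤ κ₀) (hκ : 0 ≤ κ) (a : ℝ) (M : ℕ) (x₀ : V)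
    (u : ℕ → V) (x : V) : 0 ≤ chainFun κ₀ κ a M x₀ u x := by
  unfold chainFun
  positivity

theorem norm_chainGrad_sub_le {κ₀ κ : ℝ} (hκ₀ : 0 ≤ κ₀) (hκ : 0 ≤ κ) (a : ℝ) {M : ℕ} (x₀ : V)
    {u : ℕ → V} (hu : OrthonormalBelow u (M + 1)) (x y : V) :
    ‖chainGrad κ₀ κ a M x₀ u x - chainGrad κ₀ κ a M x₀ u y‖ ≤ (κ₀ + 4 * κ) * ‖x - y‖ := by
  set d := x - y with hd
  let c : ℕ → ℝ := fun i => inner ℝ (u i) d - inner ℝ (u (i + 1)) d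
  have e : chainGrad κ₀ κ a M x₀ u x - chainGrad κ₀ κ a M x₀ u y =
      (κ₀ * inner ℝ (u 0) d) • u 0 + κ • (∑ i ∈ Finset.range M, c i • u i -
        ∑ i ∈ Finset.range M, c i • u (i + 1)) := by
    have e1 : ∀ i, (κ * (inner ℝ (u i - u (i + 1)) (x - x₀) - 0)) • (u i - u (i + 1)) -
        (κ * (inner ℝ (u i - u (i + 1)) (y - x₀) - 0)) • (u i - u (i + 1)) =
        κ • (c i • u i - c i • u (i + 1)) := by
      intro i
      rw [← sub_smul, ← smul_sub, smul_smul]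
      congr 1
      simp only [c, hd, inner_sub_left, inner_sub_right]
      ring
    have e2 : (κ₀ * (inner ℝ (u 0) (x - x₀) - a)) • u 0 - (κ₀ * (inner ℝ (u 0) (y - x₀) - a)) • u 0
        = (κ₀ * inner ℝ (u 0) d) • u 0 := by
      rw [← sub_smul]
      congr 1
      simp only [hd, inner_sub_right]
      ring
    unfold chainGrad
    rw [add_sub_add_comm, e2, ← Finset.sum_sub_distrib, Finset.sum_congr rfl fun i _ => e1 i,
      ← Finset.smul_sum, Finset.sum_sub_distrib]
  have hu0 : ‖u 0‖ = 1 := by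
    have := hu 0 (by omega) 0 (by omega)
    rw [if_pos rfl, real_inner_self_eq_norm_sq] at this
    exact (pow_eq_one_iff_of_nonneg (norm_nonneg _) two_ne_zero).1 this
  have hcs : ∑ i ∈ Finset.range M, c i ^ 2 ≤ (2 * ‖d‖) ^ 2 := by
    have h1 := (hu.mono M.le_succ).sum_inner_sq_le d
    have h2 := hu.shift.sum_inner_sq_le d
    have h3 : ∑ i ∈ Finset.range M, c i ^ 2 ≤ ∑ i ∈ Finset.range M,
        (2 * inner ℝ (u i) d ^ 2 + 2 * inner ℝ (u (i + 1)) d ^ 2) :=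
      Finset.sum_le_sum fun i _ => by
        simp only [c]
        nlinarith [sq_nonneg (inner ℝ (u i) d + inner ℝ (u (i + 1)) d)]
    rw [Finset.sum_add_distrib, ← Finset.mul_sum, ← Finset.mul_sum] at h3
    nlinarith
  have h1 : ‖∑ i ∈ Finset.range M, c i • u i‖ ≤ 2 * ‖d‖ :=
    le_of_sq_le_sq (((hu.mono M.le_succ).norm_sum_sq c).trans_le hcs) (by positivity)
  have h2 : ‖∑ i ∈ Finset.range M, c i • u (i + 1)‖ ≤ 2 * ‖d‖ :=
    le_of_sq_le_sq ((hu.shift.norm_sum_sq c).trans_le hcs) (by positivity)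
  rw [e]
  refine (norm_add_le _ _).trans ?_
  rw [norm_smul, norm_smul, norm_mul, hu0, mul_one, Real.norm_of_nonneg hκ₀, Real.norm_of_nonneg hκ,
    add_mul]
  refine add_le_add (mul_le_mul_of_nonneg_left ?_ hκ₀) ?_
  · simpa [hu0] using norm_inner_le_norm (𝕜 := ℝ) (u 0) d
  · have := mul_le_mul_of_nonneg_left ((norm_sub_le (∑ i ∈ Finset.range M, c i • u i)
      (∑ i ∈ Finset.range M, c i • u (i + 1))).trans (add_le_add h1 h2)) hκ
    linarith

/-- The gradient of the chain is large wherever the last coordinate vanishes. -/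
theorem sq_le_norm_chainGrad_sq {κ₀ κ : ℝ} (hκ₀ : 0 < κ₀) (hκ : 0 ≤ κ) (a : ℝ) {M : ℕ}
    (hM : M ≠ 0 → 0 < κ) (x₀ : V) {u : ℕ → V} (hu : OrthonormalBelow u (M + 1)) {x : V}
    (hx : inner ℝ (u M) (x - x₀) = 0) :
    a ^ 2 ≤ ‖chainGrad κ₀ κ a M x₀ u x‖ ^ 2 * ((M + 1) * (1 / κ₀ + M / κ) ^ 2) := by
  -- Testing the gradient against `w` telescopes: the springs have `κ (c i - c (i + 1)) = -1`, and
  -- `κ₀ c 0 = 1`, so only the end coordinate and `-a` survive.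
  let c : ℕ → ℝ := fun j => 1 / κ₀ + j / κ
  set w := ∑ j ∈ Finset.range (M + 1), c j • u j with hw
  have h1 : inner ℝ (chainGrad κ₀ κ a M x₀ u x) w = -a := by
    rw [chainGrad, inner_add_left, sum_inner, inner_smul_left, hu.inner_sum M.succ_pos]
    have e : ∀ i ∈ Finset.range M, inner ℝ ((κ * (inner ℝ (u i - u (i + 1)) (x - x₀) - 0)) •
        (u i - u (i + 1))) w = inner ℝ (u (i + 1)) (x - x₀) - inner ℝ (u i) (x - x₀) := by
      intro i hi
      rw [Finset.mem_range] at hi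
      have hκ' := (hM (by omega)).ne'
      rw [inner_smul_left, inner_sub_left (u i) (u (i + 1)) w, hu.inner_sum (by omega),
        hu.inner_sum (by omega), inner_sub_left, conj_trivial]
      simp only [c]
      push_cast
      field_simp
      ring
    rw [Finset.sum_congr rfl e, Finset.sum_range_sub (fun i => inner ℝ (u i) (x - x₀)), hx]
    simp only [c, conj_trivial]
    push_cast
    field_simp
    ring
  have h2 : ‖w‖ ^ 2 ≤ (M + 1) * (1 / κ₀ + M / κ) ^ 2 := by
    rw [hw, hu.norm_sum_sq]
    have : ∀ j ∈ Finset.range (M + 1), c j ^ 2 ≤ (1 / κ₀ + M / κ) ^ 2 := by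
      intro j hj
      have hj' : (j : ℝ) ≤ M := by exact_mod_cast Nat.lt_succ_iff.1 (Finset.mem_range.1 hj)
      simp only [c]
      gcongr
    refine (Finset.sum_le_card_nsmul _ _ _ this).trans (le_of_eq ?_)
    simp
  have h3 := abs_real_inner_le_norm (chainGrad κ₀ κ a M x₀ u x) w
  rw [h1, abs_neg] at h3
  calc a ^ 2 = |a| ^ 2 := (sq_abs a).symm
    _ ≤ (‖chainGrad κ₀ κ a M x₀ u x‖ * ‖w‖) ^ 2 := by gcongr
    _ = ‖chainGrad κ₀ κ a M x₀ u x‖ ^ 2 * ‖w‖ ^ 2 := mul_pow _ _ _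
    _ ≤ _ := by gcongr

theorem hasGradientAt_affine_sq [CompleteSpace V] (c a : ℝ) (b x₀ x : V) :
    HasGradientAt (fun x => c / 2 * (inner ℝ b (x - x₀) - a) ^ 2)
      ((c * (inner ℝ b (x - x₀) - a)) • b) x := by
  rw [hasGradientAt_iff_hasFDerivAt]
  have h1 : HasFDerivAt (fun x => inner ℝ b (x - x₀) - a) (innerSL ℝ b) x :=
    ((innerSL ℝ b).hasFDerivAt.comp x ((hasFDerivAt_id x).sub_const x₀)).sub_const a
  refine ((h1.pow 2).const_mul (c / 2)).congr_fderiv ?_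
  ext v
  simp
  ring

theorem hasGradientAt_chainFun [CompleteSpace V] (κ₀ κ a : ℝ) (M : ℕ) (x₀ : V) (u : ℕ → V) (x : V) :
    HasGradientAt (chainFun κ₀ κ a M x₀ u) (chainGrad κ₀ κ a M x₀ u x) x := by
  have h1 := hasGradientAt_affine_sq κ₀ a (u 0) x₀ x
  have h2 := fun i => hasGradientAt_affine_sq κ 0 (u i - u (i + 1)) x₀ x
  simp only [hasGradientAt_iff_hasFDerivAt] at h1 h2 ⊢
  rw [chainGrad, map_add, map_sum]
  exact h1.add (HasFDerivAt.fun_sum fun i _ => h2 i)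

/-- The level `√(2 Δ / κ₀)` stores energy exactly `Δ` in the first spring at `x₀`; all springs relax
where every coordinate equals the level. -/
theorem isInstance_chainFun [CompleteSpace V] {β Δ κ₀ κ : ℝ} (hΔ : 0 ≤ Δ) (hκ₀ : 0 < κ₀)
    (hκ : 0 ≤ κ) (hβ : κ₀ + 4 * κ ≤ β) {M : ℕ} (x₀ : V) {u : ℕ → V}
    (hu : OrthonormalBelow u (M + 1)) :
    IsInstance β Δ x₀ (chainFun κ₀ κ √(2 * Δ / κ₀) M x₀ u) := by
  set a := √(2 * Δ / κ₀) with ha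
  have hbdd : BddBelow (Set.range (chainFun κ₀ κ a M x₀ u)) :=
    ⟨0, Set.forall_mem_range.2 (chainFun_nonneg hκ₀.le hκ a M x₀ u)⟩
  refine ⟨convexOn_chainFun hκ₀.le hκ a M x₀ u,
    fun x => (hasGradientAt_chainFun κ₀ κ a M x₀ u x).differentiableAt, fun x y => ?_, hbdd, ?_⟩
  · rw [gradient_eq (hasGradientAt_chainFun κ₀ κ a M x₀ u)]
    exact (norm_chainGrad_sub_le hκ₀.le hκ a x₀ hu x y).trans (by gcongr)
  · have h1 : ⨅ x, chainFun κ₀ κ a M x₀ u x = 0 := by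
      refine le_antisymm ?_ (le_ciInf (chainFun_nonneg hκ₀.le hκ a M x₀ u))
      refine (ciInf_le hbdd (x₀ + ∑ j ∈ Finset.range (M + 1), a • u j)).trans (le_of_eq ?_)
      have h2 : ∀ i < M + 1, inner ℝ (u i) (∑ j ∈ Finset.range (M + 1), a • u j) = a :=
        fun i hi => hu.inner_sum hi fun _ => a
      rw [chainFun, add_sub_cancel_left, h2 0 M.succ_pos, Finset.sum_eq_zero, sub_self]
      · simp
      · intro i hi
        rw [Finset.mem_range] at hi
        rw [inner_sub_left, h2 i (by omega), h2 (i + 1) (by omega)]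
        simp
    rw [h1, chainFun, sub_self]
    simp only [inner_zero_right, sub_zero, zero_sub, neg_sq, ne_eq, OfNat.ofNat_ne_zero,
      not_false_eq_true, zero_pow, mul_zero, Finset.sum_const_zero, add_zero]
    rw [ha, Real.sq_sqrt (by positivity)]
    field_simp

/-- The answer to a query orthogonal to the directions `u k, …, u M` depends on `u 0, …, u k`
only. -/
theorem chainGrad_congr {κ₀ κ a : ℝ} {M k : ℕ} {x₀ x : V} {u v : ℕ → V}
    (huv : ∀ i ≤ k, u i = v i) (hv : ∀ i, k < i → v i = 0)
    (hx : ∀ i, k ≤ i → i ≤ M → inner ℝ (u i) (x - x₀) = 0) :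
    chainGrad κ₀ κ a M x₀ u x = chainGrad κ₀ κ a M x₀ v x := by
  unfold chainGrad
  rw [huv 0 k.zero_le]
  congr 1
  refine Finset.sum_congr rfl fun i hi => ?_
  rw [Finset.mem_range] at hi
  rcases lt_or_ge i k with hik | hik
  · rw [huv i hik.le, huv (i + 1) hik]
  · have h1 : inner ℝ (v i) (x - x₀) = 0 := by
      rcases hik.eq_or_lt with rfl | hlt
      · rw [← huv k le_rfl, hx k le_rfl hi.le]
      · rw [hv i hlt, inner_zero_left]
    rw [inner_sub_left, inner_sub_left, hx i hik hi.le, hx (i + 1) (by omega) hi, h1,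
      hv (i + 1) (by omega), inner_zero_left]
    simp

theorem exists_unit_mem_orthogonal [FiniteDimensional ℝ V] {S : Submodule ℝ V}
    (hS : Module.finrank ℝ S < Module.finrank ℝ V) : ∃ e ∈ Sᗮ, inner ℝ e e = (1 : ℝ) := by
  have h : Sᗮ ≠ ⊥ := by
    intro h
    have := S.finrank_add_finrank_orthogonal
    rw [h, finrank_bot] at this
    omega
  obtain ⟨v, hv, hv0⟩ := Submodule.exists_mem_ne_zero_of_ne_bot h
  refine ⟨‖v‖⁻¹ • v, Submodule.smul_mem _ _ hv, ?_⟩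
  rw [real_inner_self_eq_norm_sq, norm_smul, norm_inv, norm_norm,
    inv_mul_cancel₀ (norm_ne_zero_iff.2 hv0), one_pow]

theorem finrank_sup_span_singleton_le [FiniteDimensional ℝ V] (S : Submodule ℝ V) (e : V) :
    Module.finrank ℝ (S ⊔ Submodule.span ℝ {e} : Submodule ℝ V) ≤ Module.finrank ℝ S + 1 :=
  (Submodule.finrank_add_le_finrank_add_finrank _ _).trans
    (Nat.add_le_add_left ((finrank_span_le_card ({e} : Set V)).trans (by simp)) _)

/-- The resisting oracle: the directions of the chain that a procedure has not yet discovered can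
be chosen orthogonal to its queries, one new direction per query. -/
theorem exists_resisting_chain [FiniteDimensional ℝ V] (κ₀ κ a : ℝ) (M : ℕ) (x₀ : V) (m : ℕ) :
    ∀ (k : ℕ), k + m = M + 1 → ∀ (P : Procedure V V) (u : ℕ → V) (S : Submodule ℝ V),
      OrthonormalBelow u k → (∀ i, k ≤ i → u i = 0) → (∀ i < k, u i ∈ S) →
      Module.finrank ℝ S + 2 * m ≤ Module.finrank ℝ V →
      ∃ u' : ℕ → V, OrthonormalBelow u' (M + 1) ∧ (∀ i < k, u' i = u i) ∧
        (∀ i, k ≤ i → i ≤ M → u' i ∈ Sᗮ) ∧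
        (m ≤ P.numQueries (chainGrad κ₀ κ a M x₀ u') ∨
          inner ℝ (u' M) (P.run (chainGrad κ₀ κ a M x₀ u') - x₀) = 0) := by
  induction m with
  | zero =>
    intro k hk P u S hu _ _ _
    exact ⟨u, by rwa [← hk], fun _ _ => rfl, fun i h1 h2 => by omega, Or.inl (Nat.zero_le _)⟩
  | succ m ih =>
    intro k hk P u S hu hu0 huS hdim
    -- `v` fixes direction `k` and sets later ones to zero, which suffices to answer the query `q`;
    -- `u'` completes it. The continuation `F` may depend on `v` through this answer.
    have step : ∀ (q : V) (F : (ℕ → V) → Procedure V V), ∃ v u' : ℕ → V,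
        (∀ i ≤ k, u' i = v i) ∧ (∀ i, k < i → v i = 0) ∧
        OrthonormalBelow u' (M + 1) ∧ (∀ i < k, u' i = u i) ∧
        (∀ i, k ≤ i → i ≤ M → u' i ∈ Sᗮ) ∧
        (∀ i, k ≤ i → i ≤ M → inner ℝ (u' i) (q - x₀) = 0) ∧
        (m ≤ (F v).numQueries (chainGrad κ₀ κ a M x₀ u') ∨
          inner ℝ (u' M) ((F v).run (chainGrad κ₀ κ a M x₀ u') - x₀) = 0) := by
      intro q F
      set T := S ⊔ Submodule.span ℝ {q - x₀} with hT
      have hTdim := finrank_sup_span_singleton_le S (q - x₀)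
      rw [← hT] at hTdim
      have hST : S ≤ T := le_sup_left
      have hqT : q - x₀ ∈ T := le_sup_right (a := S) (Submodule.mem_span_singleton_self _)
      -- The new direction avoids the query as well as `S`; the two together use up two dimensions
      -- per stage.
      obtain ⟨e, heT, he⟩ := exists_unit_mem_orthogonal (S := T) (by omega)
      set T' := T ⊔ Submodule.span ℝ {e} with hT'
      have hTdim' := finrank_sup_span_singleton_le T e
      rw [← hT'] at hTdim'
      have hTT' : T ≤ T' := le_sup_left
      have heT' : e ∈ T' := le_sup_right (a := T) (Submodule.mem_span_singleton_self _)
      set v := Function.update u k e with hv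
      have hvk : v k = e := Function.update_self _ _ _
      have hvne : ∀ i, i ≠ k → v i = u i := fun i hi => Function.update_of_ne hi _ _
      have heu : ∀ i < k, inner ℝ (u i) e = 0 := fun i hi =>
        (Submodule.mem_orthogonal _ _).1 heT _ (hST (huS i hi))
      have hvo : OrthonormalBelow v (k + 1) := by
        intro i hi j hj
        rcases (Nat.lt_succ_iff.1 hi).eq_or_lt with rfl | hi'
        · rcases (Nat.lt_succ_iff.1 hj).eq_or_lt with rfl | hj'
          · rw [hvk, he, if_pos rfl]
          · rw [hvk, hvne j hj'.ne, real_inner_comm, heu j hj', if_neg hj'.ne']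
        · rcases (Nat.lt_succ_iff.1 hj).eq_or_lt with rfl | hj'
          · rw [hvk, hvne i hi'.ne, heu i hi', if_neg hi'.ne]
          · rw [hvne i hi'.ne, hvne j hj'.ne, hu i hi' j hj']
      have hv0 : ∀ i, k + 1 ≤ i → v i = 0 := fun i hi => by
        rw [hvne i (by omega), hu0 i (by omega)]
      have hvT : ∀ i < k + 1, v i ∈ T' := by
        intro i hi
        rcases (Nat.lt_succ_iff.1 hi).eq_or_lt with rfl | hi'
        · rwa [hvk]
        · rw [hvne i hi'.ne]
          exact hTT' (hST (huS i hi'))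
      obtain ⟨u', h1, h2, h3, h4⟩ := ih (k + 1) (by omega) (F v) v T' hvo hv0 hvT (by omega)
      have hT_orth : ∀ i, k ≤ i → i ≤ M → u' i ∈ Tᗮ := by
        intro i hi hiM
        rcases hi.eq_or_lt with rfl | hi'
        · rwa [h2 k k.lt_succ_self, hvk]
        · exact Submodule.orthogonal_le hTT' (h3 i hi' hiM)
      refine ⟨v, u', fun i hi => h2 i (Nat.lt_succ_iff.2 hi), hv0, h1, fun i hi => ?_,
        fun i hi hiM => Submodule.orthogonal_le hST (hT_orth i hi hiM),
        fun i hi hiM => (Submodule.mem_orthogonal' _ _).1 (hT_orth i hi hiM) _ hqT, h4⟩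
      rw [h2 i (by omega), hvne i hi.ne]
    cases P with
    | done z =>
      -- The returned point is treated as one more query, which makes it orthogonal to direction
      -- `M`.
      obtain ⟨v, u', -, -, h1, h2, h3, h4, -⟩ := step z fun _ => .done z
      exact ⟨u', h1, h2, h3, Or.inr (h4 M (by omega) le_rfl)⟩
    | query x next =>
      obtain ⟨v, u', huv, hv, h1, h2, h3, h4, h5⟩ :=
        step x fun v => next (chainGrad κ₀ κ a M x₀ v x)
      refine ⟨u', h1, h2, h3, ?_⟩
      simp only [Procedure.numQueries, Procedure.run, chainGrad_congr huv hv h4]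
      exact h5.imp_left Nat.succ_le_succ

theorem exists_hard_instance [FiniteDimensional ℝ V] {β Δ γ κ₀ κ : ℝ} (hΔ : 0 ≤ Δ)
    (hκ₀ : 0 < κ₀) (hκ : 0 ≤ κ) (hβ : κ₀ + 4 * κ ≤ β) {M : ℕ} (hM : M ≠ 0 → 0 < κ)
    (hγ : γ ^ 2 * ((M + 1) * (1 / κ₀ + M / κ) ^ 2) < 2 * Δ / κ₀)
    (hdim : 2 * (M + 1) ≤ Module.finrank ℝ V) (x₀ : V) (P : Procedure V V)
    (hP : ∀ h : V → ℝ, IsInstance β Δ x₀ h → ‖gradient h (P.run (gradient h))‖ ≤ γ) :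
    ∃ h : V → ℝ, IsInstance β Δ x₀ h ∧ M + 1 ≤ P.numQueries (gradient h) := by
  set a := √(2 * Δ / κ₀) with ha
  obtain ⟨u, hu, -, -, h⟩ := exists_resisting_chain κ₀ κ a M x₀ (M + 1) 0 (by omega) P 0 ⊥
    (fun i hi => absurd hi i.not_lt_zero) (fun _ _ => rfl) (fun i hi => absurd hi i.not_lt_zero)
    (by rw [finrank_bot]; omega)
  have hinst : IsInstance β Δ x₀ (chainFun κ₀ κ a M x₀ u) :=
    isInstance_chainFun hΔ hκ₀ hκ hβ x₀ hu
  have hgrad := gradient_eq (hasGradientAt_chainFun κ₀ κ a M x₀ u)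
  refine ⟨_, hinst, ?_⟩
  rw [hgrad]
  refine h.resolve_right fun h0 => ?_
  have h1 := sq_le_norm_chainGrad_sq hκ₀ hκ a hM x₀ hu h0
  have h2 := hP _ hinst
  rw [hgrad] at h2
  rw [ha, Real.sq_sqrt (by positivity)] at h1
  refine absurd (h1.trans ?_) (not_le.2 hγ)
  gcongr

theorem query_lower_bound {β Δ γ : ℝ} (hβ : 0 < β) (hΔ : 0 < Δ) (hγ : 0 < γ)
    (hγ' : γ < √(2 * β * Δ)) : ∃ N : ℕ, ∀ (V : Type) [NormedAddCommGroup V]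
      [InnerProductSpace ℝ V] [FiniteDimensional ℝ V], N ≤ Module.finrank ℝ V →
      ∀ (x₀ : V) (P : Procedure V V),
        (∀ h : V → ℝ, IsInstance β Δ x₀ h → ‖gradient h (P.run (gradient h))‖ ≤ γ) →
        ∃ h : V → ℝ, IsInstance β Δ x₀ h ∧
          1 / 8 * (√(β * Δ) / γ) ≤ (P.numQueries (gradient h) : ℝ) := by
  set r := √(β * Δ) / γ with hr
  have hr2 : r ^ 2 * γ ^ 2 = β * Δ := by
    rw [hr, div_pow, Real.sq_sqrt (by positivity)]
    field_simp
  have hr0 : 0 ≤ r := by positivity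
  rcases le_or_gt r 8 with hr8 | hr8
  -- For small `r` one query is enough: a single spring of stiffness `β`, with `M = 0`.
  · refine ⟨2, fun V _ _ _ hdim x₀ P hP => ?_⟩
    have hγ2 : γ ^ 2 < 2 * β * Δ := (Real.lt_sqrt hγ.le).1 hγ'
    obtain ⟨h, h1, h2⟩ := exists_hard_instance (β := β) (Δ := Δ) (γ := γ) (κ₀ := β) (κ := 0)
      (M := 0) hΔ.le hβ le_rfl (by simp) (by simp) (by
        simp only [Nat.cast_zero, zero_add, zero_div, add_zero, one_mul, div_pow, one_pow]
        rw [mul_one_div, div_lt_div_iff₀ (by positivity) hβ]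
        nlinarith) hdim x₀ P hP
    refine ⟨h, h1, ?_⟩
    have : (1 : ℝ) ≤ (P.numQueries (gradient h) : ℝ) := by exact_mod_cast h2
    linarith
  · set M := ⌊r / 8⌋₊ with hM
    have hM1 : (M : ℝ) ≤ r / 8 := Nat.floor_le (by positivity)
    have hM2 : r / 8 < M + 1 := Nat.lt_floor_add_one _
    refine ⟨2 * (M + 1), fun V _ _ _ hdim x₀ P hP => ?_⟩
    have hm : (0 : ℝ) < M + 1 := by positivity
    -- The soft first spring makes `1 / κ₀` comparable to `M / κ`. It raises `a²` to order `M Δ /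
    -- β`, so the gradient bound is of order `√(β Δ) / M`.
    obtain ⟨h, h1, h2⟩ := exists_hard_instance (β := β) (Δ := Δ) (γ := γ)
      (κ₀ := β / (5 * (M + 1))) (κ := β / 5) (M := M) hΔ.le (by positivity) (by positivity)
      (by
        have : β / (5 * (M + 1)) ≤ β / 5 := by
          gcongr
          linarith [(Nat.cast_nonneg M : (0 : ℝ) ≤ M)]
        linarith)
      (fun _ => by positivity) (by
        have e1 : 1 / (β / (5 * (M + 1))) + M / (β / 5) ≤ 10 * (M + 1) / β := by
          rw [one_div_div, div_div_eq_mul_div, ← add_div]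
          gcongr
          linarith
        have e2 : (10 * (M + 1)) * (M + 1) * γ ^ 2 < β * Δ := by
          rw [← hr2]
          have : (M : ℝ) + 1 ≤ r / 4 := by linarith
          have h3 : ((M : ℝ) + 1) ^ 2 ≤ (r / 4) ^ 2 := by gcongr
          have h4 : (10 * ((M : ℝ) + 1)) * (M + 1) < r ^ 2 := by nlinarith
          gcongr
        calc γ ^ 2 * ((M + 1) * (1 / (β / (5 * (M + 1))) + M / (β / 5)) ^ 2)
            ≤ γ ^ 2 * ((M + 1) * (10 * (M + 1) / β) ^ 2) := by gcongr
          _ = 10 * (M + 1) / β ^ 2 * ((10 * (M + 1)) * (M + 1) * γ ^ 2) := by ring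
          _ < 10 * (M + 1) / β ^ 2 * (β * Δ) := by gcongr
          _ = 2 * Δ / (β / (5 * (M + 1))) := by field_simp; ring) hdim x₀ P hP
    refine ⟨h, h1, ?_⟩
    have : (M + 1 : ℝ) ≤ (P.numQueries (gradient h) : ℝ) := by exact_mod_cast h2
    linarith

end LowerBound

end CriticalPoint

theorem theorem6p1 :
    -- the guarantee, for every CGM oracle and every `K = O(log)` above an explicit threshold
    (∀ c A : ℝ, ∃ C : ℝ, 0 < C ∧
      ∀ (n : ℕ) (β Δ γ : ℝ) (x₀ : EuclideanSpace ℝ (Fin n)) (h : EuclideanSpace ℝ (Fin n) → ℝ),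
        IsInstance β Δ x₀ h → 0 < γ → γ < √(2 * β * Δ) →
        ∀ cgm : ℝ → EuclideanSpace ℝ (Fin n) → ℝ →
            Procedure (EuclideanSpace ℝ (Fin n)) (EuclideanSpace ℝ (Fin n)),
          IsCGM β c (regularized Δ γ x₀ h) cgm →
          ∀ K : ℕ, iterationCount β Δ γ ≤ K → (K : ℝ) ≤ A * iterationCount β Δ γ →
            ‖gradient h ((algorithm Δ γ x₀ cgm K).run (gradient h))‖ ≤ γ ∧
            ((algorithm Δ γ x₀ cgm K).numQueries (gradient h) : ℝ) ≤ C * (√(β * Δ) / γ)) ∧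
    -- CGM oracles exist, with a universal constant and without knowledge of `h`
    (∃ c : ℝ, 0 < c ∧
      ∀ (n : ℕ) (β Δ γ : ℝ) (x₀ : EuclideanSpace ℝ (Fin n)), 0 < γ → γ < √(2 * β * Δ) →
        ∃ cgm : ℝ → EuclideanSpace ℝ (Fin n) → ℝ →
            Procedure (EuclideanSpace ℝ (Fin n)) (EuclideanSpace ℝ (Fin n)),
          ∀ h : EuclideanSpace ℝ (Fin n) → ℝ, IsInstance β Δ x₀ h →
            IsCGM β c (regularized Δ γ x₀ h) cgm) ∧
    -- optimality: in high dimension no procedure does better by more than a constant factor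
    (∃ c : ℝ, 0 < c ∧
      ∀ β Δ γ : ℝ, 0 < β → 0 < Δ → 0 < γ → γ < √(2 * β * Δ) →
        ∃ N : ℕ, ∀ n : ℕ, N ≤ n → ∀ (x₀ : EuclideanSpace ℝ (Fin n))
          (P : Procedure (EuclideanSpace ℝ (Fin n)) (EuclideanSpace ℝ (Fin n))),
          (∀ h : EuclideanSpace ℝ (Fin n) → ℝ, IsInstance β Δ x₀ h →
            ‖gradient h (P.run (gradient h))‖ ≤ γ) →
          ∃ h : EuclideanSpace ℝ (Fin n) → ℝ, IsInstance β Δ x₀ h ∧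
            c * (√(β * Δ) / γ) ≤ (P.numQueries (gradient h) : ℝ)) := by
  refine ⟨fun c A => ?_, ⟨2, two_pos, fun n β Δ γ x₀ hγ hγ' => exists_isCGM hγ hγ'⟩,
    1 / 8, by norm_num, fun β Δ γ hβ hΔ hγ hγ' => ?_⟩
  · obtain ⟨C, hC, h⟩ := algorithm_guarantee c A
    exact ⟨C, hC, fun n => h (EuclideanSpace ℝ (Fin n))⟩
  · obtain ⟨N, h⟩ := query_lower_bound hβ hΔ hγ hγ'
    exact ⟨N, fun n hn => h (EuclideanSpace ℝ (Fin n)) (by simpa using hn)⟩
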